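/- Let $\Bbbk$ be a commutative ring, let $q,t\in\Bbbk^\times$, and let $d\in\Bbbk$ satisfy $d\,(q-q^{-1})=t-t^{-1}$ (so $d$ is a value of $\frac{t-t^{-1}}{q-q^{-1}}$). Diagrams are read from bottom to top; a crossing is *positive* if the strand going from bottom left to top right passes over the other one, and *negative* if it passes under. **The oriented skein category.** $\mathcal{OS}(q,t)$ is the $\Bbbk$-linear strict monoidal category with unit object $\mathbf 1$, generated by two objects $\uparrow,\downarrow$ and the morphisms $$\sigma^{+},\sigma^{-}\colon\uparrow\uparrow\,\to\,\uparrow\uparrow,\quad \mathrm{cup}_R\colon\mathbf 1\to\,\downarrow\uparrow,\quad \mathrm{cap}_R\colon\uparrow\downarrow\,\to\mathbf 1,\quad \mathrm{cup}_L\colon\mathbf 1\to\,\uparrow\downarrow,\quad \mathrm{cap}_L\colon\downarrow\uparrow\,\to\mathbf 1$$ (the positive and negative upward crossings, and the cups and caps oriented to the right, resp. to the left), subject to the following relations, in which an object stands for its identity morphism and juxtaposition for $\otimes$: - $\sigma^+\sigma^-=\sigma^-\sigma^+=1$, $\ (\sigma^+\!\uparrow)(\uparrow\!\sigma^+)(\sigma^+\!\uparrow)=(\uparrow\!\sigma^+)(\sigma^+\!\uparrow)(\uparrow\!\sigma^+)$,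 and the morphisms $\rho:=(\downarrow\uparrow\mathrm{cap}_R)\circ(\downarrow\sigma^+\downarrow)\circ(\mathrm{cup}_R\uparrow\downarrow)\colon\uparrow\downarrow\,\to\,\downarrow\uparrow$ and $\lambda:=(\mathrm{cap}_L\uparrow\downarrow)\circ(\downarrow\sigma^-\downarrow)\circ(\downarrow\uparrow\mathrm{cup}_L)\colon\downarrow\uparrow\,\to\,\uparrow\downarrow$ are mutually inverse; - $\sigma^+-\sigma^-=(q-q^{-1})\,1$; - $(\mathrm{cap}_L\uparrow)\circ(\downarrow\sigma^+)\circ(\mathrm{cup}_R\uparrow)=t\,1_\uparrow=(\uparrow\mathrm{cap}_R)\circ(\sigma^+\downarrow)\circ(\uparrow\mathrm{cup}_L)$ and $\mathrm{cap}_R\circ\mathrm{cup}_L=d\,1_{\mathbf 1}$; - $(\mathrm{cap}_R\uparrow)\circ(\uparrow\mathrm{cup}_R)=1_\uparrow$ and $(\downarrow\mathrm{cap}_R)\circ(\mathrm{cup}_R\downarrow)=1_\downarrow$. **The iquantum Brauer category.** $\mathrm{iq}\mathcal B(q,t)$ is the $\Bbbk$-linear category with objects $\mathsf B_r$, $r\in\mathbb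 N$, and generating morphisms $\cup_r\colon\mathsf B_r\to\mathsf B_{r+2}$ and $\cap_r\colon\mathsf B_{r+2}\to\mathsf B_r$ (a cup, resp. a cap, to the left of $r$ vertical strands), $X_i^{+},X_i^{-}\colon\mathsf B_n\to\mathsf B_n$ for $0\le i\le n-2$ (a positive, resp. negative, crossing with $i$ vertical strands on its left and $n-i-2$ on its right), subject to the following relations whenever they make sense: - $X_i^+X_i^-=X_i^-X_i^+=1$, $\ X_i^+X_{i+1}^+X_i^+=X_{i+1}^+X_i^+X_{i+1}^+$, $\ X_i^+-X_i^-=(q-q^{-1})\,1$; - $\cap_{r+1}X_1^+\cup_{r+1}=t\,1$, $\ \cap_rX_0^+=q\,\cap_r$, $\ X_0^+\cup_r=q\,\cup_r$, $\ \cap_r\cup_r=d\,1$; - $\cap_{r+2}X_1^+X_2^+X_0^-X_1^-\cup_{r+2}=\cup_r\cap_r$, $\ \cap_r\cap_{r+2}X_1^+X_2^+X_0^-X_1^-=\cap_r\cap_{r+2}$, $\ X_1^-X_0^-X_2^+X_1^+\cup_{r+2}\cup_r=\cup_{r+2}\cup_r$; - for all signs $\varepsilon,\delta$: $\ \cup_nX_i^\varepsilon=X_{i+2}^\varepsilon\cup_n$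 and $\cap_nX_{i+2}^\varepsilon=X_i^\varepsilon\cap_n$ for $0\le i\le n-2$; and $X_i^\varepsilon X_j^\delta=X_j^\delta X_i^\varepsilon$ if $i+2\le j$. Adding a vertical strand on the right of every diagram defines a $\Bbbk$-linear endofunctor $\mathbf A_1$ of $\mathrm{iq}\mathcal B(q,t)$; it sends $\mathsf B_r$ to $\mathsf B_{r+1}$, $\cup_r\mapsto\cup_{r+1}$, $\cap_r\mapsto\cap_{r+1}$, $X_i^\pm\mapsto X_i^\pm$. Put $\mathbf A_2=\mathbf A_1\circ\mathbf A_1$. Let $\mathcal End(\mathrm{iq}\mathcal B(q,t))$ be the strict monoidal category of $\Bbbk$-linear endofunctors of $\mathrm{iq}\mathcal B(q,t)$, with composition as tensor product, and let the superscript $\mathrm{rev}$ denote the reversal of the tensor product. **Theorem.** There is a $\Bbbk$-linear strict monoidal functor $$\mathbf A\colon\mathcal{OS}(q,t)\to\mathcal End(\mathrm{iq}\mathcal B(q,t))^{\mathrm{rev}}$$ such that $\mathbf A(\uparrow)=\mathbf A(\downarrow)=\mathbf A_1$ and such that the natural transformations $\mathbf A(\sigma^\pm)\colon\mathbf A_2\to\mathbf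 A_2$, $\mathbf A(\mathrm{cup}_R),\mathbf A(\mathrm{cup}_L)\colon\mathrm{id}\to\mathbf A_2$ and $\mathbf A(\mathrm{cap}_R),\mathbf A(\mathrm{cap}_L)\colon\mathbf A_2\to\mathrm{id}$ have, for every $r\in\mathbb N$, the components $$\mathbf A(\sigma^\pm)_{\mathsf B_r}=X_r^\pm,$$ $$\mathbf A(\mathrm{cup}_R)_{\mathsf B_r}=(X^-_{r-1}\cdots X^-_1X^-_0)(X^+_r\cdots X^+_2X^+_1)\cup_r,\qquad \mathbf A(\mathrm{cup}_L)_{\mathsf B_r}=q^{-1}t\,(X^+_{r-1}\cdots X^+_1X^+_0)(X^-_r\cdots X^-_2X^-_1)\cup_r,$$ $$\mathbf A(\mathrm{cap}_L)_{\mathsf B_r}=\cap_r(X^-_1X^-_2\cdots X^-_r)(X^+_0X^+_1\cdots X^+_{r-1}),\qquad \mathbf A(\mathrm{cap}_R)_{\mathsf B_r}=qt^{-1}\,\cap_r(X^+_1X^+_2\cdots X^+_r)(X^-_0X^-_1\cdots X^-_{r-1}).$$ In other words, $\mathrm{iq}\mathcal B(q,t)$ is a strict right $\mathcal{OS}(q,t)$-module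 category with $M\otimes C=\mathbf A(C)(M)$. -/

import Mathlib

open CategoryTheory MonoidalCategory

universe u v w v₁ w₁

/-! ### Linear endofunctors and strict right module categories -/

section StrictModules

attribute [local instance] endofunctorMonoidalCategory

/-- The property of being a `k`-linear endofunctor. -/
def IsLinearEndofunctor (k : Type u) [CommRing k] (M : Type w) [Category.{v} M] [Preadditive M]
    [Linear k M] : ObjectProperty (M ⥤ M) :=
  fun F => F.Additive ∧ F.Linear k

instance (k : Type u) [CommRing k] (M : Type w) [Category.{v} M] [Preadditive M]
    [Linear k M] : (IsLinearEndofunctor k M).IsMonoidal where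
  prop_unit := ⟨inferInstanceAs (𝟭 M).Additive, inferInstanceAs ((𝟭 M).Linear k)⟩
  prop_tensor := by
    rintro F G ⟨hF, hF'⟩ ⟨hG, hG'⟩
    exact ⟨inferInstanceAs (F ⋙ G).Additive, inferInstanceAs ((F ⋙ G).Linear k)⟩

/-- The strict monoidal category of `k`-linear endofunctors of `M` and natural transformations,
with the *reverse* of the usual tensor product: the tensor product of `F` and `G` is `F ⋙ G`
("first `F`, then `G`"), the usual one being `G ⋙ F`. -/
abbrev LinEndRev (k : Type u) [CommRing k] (M : Type w) [Category.{v} M] [Preadditive M]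
    [Linear k M] : Type (max v w) :=
  (IsLinearEndofunctor k M).FullSubcategory

instance LinEndRev.monoidalCategory (k : Type u) [CommRing k] (M : Type w) [Category.{v} M]
    [Preadditive M] [Linear k M] : MonoidalCategory (LinEndRev k M) :=
  ObjectProperty.fullMonoidalSubcategory _

end StrictModules

/-- A structure of strict right `C`-module category on the `k`-linear category `M`: a `k`-linear
strict monoidal functor from `C` to the reverse of the category of `k`-linear endofunctors of `M`.
A monoidal functor is strict when its structure isomorphisms are identities. -/
structure StrictRightModule (k : Type u) [CommRing k]
    (C : Type w₁) [Category.{v₁} C] [Preadditive C] [Linear k C] [MonoidalCategory C]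
    (M : Type w) [Category.{v} M] [Preadditive M] [Linear k M] where
  /-- the functor defining the action -/
  functor : C ⥤ LinEndRev k M
  additive : functor.Additive
  linear : functor.Linear k
  monoidal : functor.Monoidal
  unit_strict : ∃ h : 𝟙_ (LinEndRev k M) = functor.obj (𝟙_ C),
    Functor.LaxMonoidal.ε functor = eqToHom h
  tensor_strict : ∀ X Y : C, ∃ h : functor.obj X ⊗ functor.obj Y = functor.obj (X ⊗ Y),
    Functor.LaxMonoidal.μ functor X Y = eqToHom h

/-- The morphisms `f` and `g` are equal: their sources are equal, their targets are equal, and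
`f` is `g` after these identifications. -/
def SameHom {C : Type w} [Category.{v} C] {X Y X' Y' : C} (f : X ⟶ Y) (g : X' ⟶ Y') : Prop :=
  ∃ (hX : X = X') (hY : Y' = Y), f = eqToHom hX ≫ g ≫ eqToHom hY

/-! ### The oriented skein category -/

/-- The two generating objects `↑` and `↓`. -/
inductive Strand : Type
  | up : Strand
  | down : Strand

open Strand in
/-- The generating morphisms of the oriented skein category. In `posCross` the strand going from
bottom left to top right passes over the other one, in `negCross` it passes under. The arcs
`rightCup` and `rightCap` are oriented from left to right, `leftCup` and `leftCap` from right
to left. -/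
inductive OSGen : List Strand → List Strand → Type
  | posCross : OSGen [up, up] [up, up]
  | negCross : OSGen [up, up] [up, up]
  | rightCup : OSGen [] [down, up]
  | rightCap : OSGen [up, down] []
  | leftCup : OSGen [] [up, down]
  | leftCap : OSGen [down, up] []

/-- Formal expressions built from the generating morphisms by composition (in diagrammatic order:
`comp f g` is first `f`, then `g`, that is, `g ∘ f`), tensor product and linear combination. -/
inductive OSTerm (k : Type u) : List Strand → List Strand → Type u
  | gen {X Y : List Strand} (g : OSGen X Y) : OSTerm k X Y
  | one (X : List Strand) : OSTerm k X X
  | comp {X Y Z : List Strand} (f : OSTerm k X Y) (g : OSTerm k Y Z) : OSTerm k X Z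
  | tensor {X Y X' Y' : List Strand} (f : OSTerm k X Y) (g : OSTerm k X' Y') :
      OSTerm k (X ++ X') (Y ++ Y')
  | zero (X Y : List Strand) : OSTerm k X Y
  | add {X Y : List Strand} (f g : OSTerm k X Y) : OSTerm k X Y
  | smul {X Y : List Strand} (a : k) (f : OSTerm k X Y) : OSTerm k X Y

namespace OSTerm

open Strand OSGen

/-- Transport of an expression along equalities of words. -/
def cast {k : Type u} {X Y X' Y' : List Strand} (hX : X = X') (hY : Y = Y')
    (f : OSTerm k X Y) : OSTerm k X' Y' := hX ▸ hY ▸ f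

/-- The crossing `↑ ↓ ⟶ ↓ ↑` in which `↓` passes over `↑`:
a cup `↓ ↑` on the left, a positive upward crossing in the middle, a cap `↑ ↓` on the right. -/
def posRightCross (k : Type u) : OSTerm k [up, down] [down, up] :=
  ((gen rightCup).tensor (one [up, down])).comp
    (((one [down]).tensor ((gen posCross).tensor (one [down]))).comp
      ((one [down, up]).tensor (gen rightCap)))

/-- The crossing `↓ ↑ ⟶ ↑ ↓` in which `↓` passes over `↑`:
a cup `↑ ↓` on the right, a negative upward crossing in the middle, a cap `↓ ↑` on the left. -/
def negLeftCross (k : Type u) : OSTerm k [down, up] [up, down] :=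
  ((one [down, up]).tensor (gen leftCup)).comp
    (((one [down]).tensor ((gen negCross).tensor (one [down]))).comp
      ((gen leftCap).tensor (one [up, down])))

end OSTerm

open Strand OSGen OSTerm in
/-- Equality of morphisms in the oriented skein category: the smallest congruence on formal
expressions that contains the axioms of a `k`-linear strict monoidal category and the
defining relations. The scalar `d` is the value `(t - t⁻¹) / (q - q⁻¹)` of the bubble. -/
inductive OSRel {k : Type u} [CommRing k] (q t : kˣ) (d : k) :
    ∀ {X Y : List Strand}, OSTerm k X Y → OSTerm k X Y → Prop
  -- congruence
  | refl {X Y : List Strand} (f : OSTerm k X Y) : OSRel q t d f f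
  | symm {X Y : List Strand} {f g : OSTerm k X Y} : OSRel q t d f g → OSRel q t d g f
  | trans {X Y : List Strand} {f g h : OSTerm k X Y} :
      OSRel q t d f g → OSRel q t d g h → OSRel q t d f h
  | comp_congr {X Y Z : List Strand} {f f' : OSTerm k X Y} {g g' : OSTerm k Y Z} :
      OSRel q t d f f' → OSRel q t d g g' → OSRel q t d (f.comp g) (f'.comp g')
  | tensor_congr {X Y X' Y' : List Strand} {f f' : OSTerm k X Y} {g g' : OSTerm k X' Y'} :
      OSRel q t d f f' → OSRel q t d g g' → OSRel q t d (f.tensor g) (f'.tensor g')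
  | add_congr {X Y : List Strand} {f f' g g' : OSTerm k X Y} :
      OSRel q t d f f' → OSRel q t d g g' → OSRel q t d (f.add g) (f'.add g')
  | smul_congr {X Y : List Strand} (a : k) {f f' : OSTerm k X Y} :
      OSRel q t d f f' → OSRel q t d (f.smul a) (f'.smul a)
  -- category axioms
  | id_comp {X Y : List Strand} (f : OSTerm k X Y) : OSRel q t d ((one X).comp f) f
  | comp_id {X Y : List Strand} (f : OSTerm k X Y) : OSRel q t d (f.comp (one Y)) f
  | comp_assoc {W X Y Z : List Strand} (f : OSTerm k W X) (g : OSTerm k X Y) (h : OSTerm k Y Z) :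
      OSRel q t d ((f.comp g).comp h) (f.comp (g.comp h))
  -- module axioms
  | add_assoc {X Y : List Strand} (f g h : OSTerm k X Y) :
      OSRel q t d ((f.add g).add h) (f.add (g.add h))
  | add_comm {X Y : List Strand} (f g : OSTerm k X Y) : OSRel q t d (f.add g) (g.add f)
  | zero_add {X Y : List Strand} (f : OSTerm k X Y) : OSRel q t d ((zero X Y).add f) f
  | neg_add {X Y : List Strand} (f : OSTerm k X Y) :
      OSRel q t d ((f.smul (-1)).add f) (zero X Y)
  | one_smul {X Y : List Strand} (f : OSTerm k X Y) : OSRel q t d (f.smul 1) f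
  | mul_smul {X Y : List Strand} (a b : k) (f : OSTerm k X Y) :
      OSRel q t d (f.smul (a * b)) ((f.smul b).smul a)
  | smul_add {X Y : List Strand} (a : k) (f g : OSTerm k X Y) :
      OSRel q t d ((f.add g).smul a) ((f.smul a).add (g.smul a))
  | add_smul {X Y : List Strand} (a b : k) (f : OSTerm k X Y) :
      OSRel q t d (f.smul (a + b)) ((f.smul a).add (f.smul b))
  -- bilinearity of the composition and of the tensor product
  | add_comp {X Y Z : List Strand} (f f' : OSTerm k X Y) (g : OSTerm k Y Z) :
      OSRel q t d ((f.add f').comp g) ((f.comp g).add (f'.comp g))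
  | comp_add {X Y Z : List Strand} (f : OSTerm k X Y) (g g' : OSTerm k Y Z) :
      OSRel q t d (f.comp (g.add g')) ((f.comp g).add (f.comp g'))
  | smul_comp {X Y Z : List Strand} (a : k) (f : OSTerm k X Y) (g : OSTerm k Y Z) :
      OSRel q t d ((f.smul a).comp g) ((f.comp g).smul a)
  | comp_smul {X Y Z : List Strand} (a : k) (f : OSTerm k X Y) (g : OSTerm k Y Z) :
      OSRel q t d (f.comp (g.smul a)) ((f.comp g).smul a)
  | add_tensor {X Y X' Y' : List Strand} (f f' : OSTerm k X Y) (g : OSTerm k X' Y') :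
      OSRel q t d ((f.add f').tensor g) ((f.tensor g).add (f'.tensor g))
  | tensor_add {X Y X' Y' : List Strand} (f : OSTerm k X Y) (g g' : OSTerm k X' Y') :
      OSRel q t d (f.tensor (g.add g')) ((f.tensor g).add (f.tensor g'))
  | smul_tensor {X Y X' Y' : List Strand} (a : k) (f : OSTerm k X Y) (g : OSTerm k X' Y') :
      OSRel q t d ((f.smul a).tensor g) ((f.tensor g).smul a)
  | tensor_smul {X Y X' Y' : List Strand} (a : k) (f : OSTerm k X Y) (g : OSTerm k X' Y') :
      OSRel q t d (f.tensor (g.smul a)) ((f.tensor g).smul a)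
  -- strict monoidal category axioms
  | id_tensor_id (X Y : List Strand) :
      OSRel q t d ((one X).tensor (one Y)) (one (X ++ Y))
  | tensor_comp {X Y Z X' Y' Z' : List Strand} (f : OSTerm k X Y) (g : OSTerm k Y Z)
      (f' : OSTerm k X' Y') (g' : OSTerm k Y' Z') :
      OSRel q t d ((f.tensor f').comp (g.tensor g')) ((f.comp g).tensor (f'.comp g'))
  | tensor_assoc {X Y X' Y' X'' Y'' : List Strand} (f : OSTerm k X Y) (g : OSTerm k X' Y')
      (h : OSTerm k X'' Y'') :
      OSRel q t d ((f.tensor g).tensor h)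
        ((f.tensor (g.tensor h)).cast (List.append_assoc X X' X'').symm
          (List.append_assoc Y Y' Y'').symm)
  | unit_tensor {X Y : List Strand} (f : OSTerm k X Y) : OSRel q t d ((one []).tensor f) f
  | tensor_unit {X Y : List Strand} (f : OSTerm k X Y) :
      OSRel q t d (f.tensor (one []))
        (f.cast (List.append_nil X).symm (List.append_nil Y).symm)
  -- braid relations
  | pos_neg : OSRel q t d ((gen posCross).comp (gen negCross)) (one [up, up])
  | neg_pos : OSRel q t d ((gen negCross).comp (gen posCross)) (one [up, up])
  | braid :
      OSRel q t d
        (((gen posCross).tensor (one [up])).comp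
          (((one [up]).tensor (gen posCross)).comp ((gen posCross).tensor (one [up]))))
        (((one [up]).tensor (gen posCross)).comp
          (((gen posCross).tensor (one [up])).comp ((one [up]).tensor (gen posCross))))
  | right_left : OSRel q t d ((posRightCross k).comp (negLeftCross k)) (one [up, down])
  | left_right : OSRel q t d ((negLeftCross k).comp (posRightCross k)) (one [down, up])
  -- skein relation
  | skein :
      OSRel q t d (add (gen posCross) ((gen negCross).smul (-1)))
        ((one [up, up]).smul ((q : k) - (q⁻¹ : kˣ)))
  -- curls and bubble
  | left_curl :
      OSRel q t d
        (((gen rightCup).tensor (one [up])).comp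
          (((one [down]).tensor (gen posCross)).comp ((gen leftCap).tensor (one [up]))))
        ((one [up]).smul (t : k))
  | right_curl :
      OSRel q t d
        (((one [up]).tensor (gen leftCup)).comp
          (((gen posCross).tensor (one [down])).comp ((one [up]).tensor (gen rightCap))))
        ((one [up]).smul (t : k))
  | bubble : OSRel q t d ((gen leftCup).comp (gen rightCap)) ((one []).smul d)
  -- adjunction
  | zigzag_up :
      OSRel q t d
        (((one [up]).tensor (gen rightCup)).comp ((gen rightCap).tensor (one [up])))
        (one [up])
  | zigzag_down :
      OSRel q t d
        (((gen rightCup).tensor (one [down])).comp ((one [down]).tensor (gen rightCap)))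
        (one [down])

/-- The oriented skein category (framed HOMFLYPT skein category): its objects are the words
in `↑` and `↓`. -/
structure OSkein {k : Type u} [CommRing k] (q t : kˣ) (d : k) : Type where
  /-- the object given by a word -/
  ofWord ::
  /-- the underlying word -/
  word : List Strand

namespace OSkein

variable {k : Type u} [CommRing k] {q t : kˣ} {d : k}

/-- Morphisms are formal expressions up to `OSRel`. -/
def Hom (q t : kˣ) (d : k) (X Y : List Strand) : Type u :=
  Quot (OSRel q t d (X := X) (Y := Y))


section

variable {X Y Z X' Y' Z' : List Strand}

/-- The morphism represented by an expression. -/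
def mk (q t : kˣ) (d : k) (f : OSTerm k X Y) : Hom q t d X Y := Quot.mk _ f

instance : Add (Hom q t d X Y) where
  add := Quot.map₂ OSTerm.add (fun _ _ _ h => .add_congr (.refl _) h)
    (fun _ _ _ h => .add_congr h (.refl _))

instance : Zero (Hom q t d X Y) where
  zero := mk q t d (.zero X Y)

instance : Neg (Hom q t d X Y) where
  neg := Quot.map (OSTerm.smul (-1)) (fun _ _ h => .smul_congr _ h)

instance : AddCommGroup (Hom q t d X Y) where
  add_assoc := by rintro ⟨f⟩ ⟨g⟩ ⟨h⟩; exact Quot.sound (.add_assoc f g h)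
  add_comm := by rintro ⟨f⟩ ⟨g⟩; exact Quot.sound (.add_comm f g)
  zero_add := by rintro ⟨f⟩; exact Quot.sound (.zero_add f)
  add_zero := by rintro ⟨f⟩; exact Quot.sound (.trans (.add_comm _ _) (.zero_add f))
  neg_add_cancel := by rintro ⟨f⟩; exact Quot.sound (.neg_add f)
  nsmul := nsmulRec
  zsmul := zsmulRec

instance : SMul k (Hom q t d X Y) where
  smul a := Quot.map (OSTerm.smul a) (fun _ _ h => .smul_congr a h)

instance : Module k (Hom q t d X Y) :=
  Module.ofMinimalAxioms
    (by rintro a ⟨f⟩ ⟨g⟩; exact Quot.sound (.smul_add a f g))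
    (by rintro a b ⟨f⟩; exact Quot.sound (.add_smul a b f))
    (by rintro a b ⟨f⟩; exact Quot.sound (.mul_smul a b f))
    (by rintro ⟨f⟩; exact Quot.sound (.one_smul f))

/-- Composition of morphisms, in diagrammatic order. -/
def comp : Hom q t d X Y → Hom q t d Y Z → Hom q t d X Z :=
  Quot.map₂ OSTerm.comp (fun _ _ _ h => .comp_congr (.refl _) h)
    (fun _ _ _ h => .comp_congr h (.refl _))

/-- Tensor product of morphisms. -/
def tensor : Hom q t d X Y → Hom q t d X' Y' → Hom q t d (X ++ X') (Y ++ Y') :=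
  Quot.map₂ OSTerm.tensor (fun _ _ _ h => .tensor_congr (.refl _) h)
    (fun _ _ _ h => .tensor_congr h (.refl _))

end

instance : Category.{u} (OSkein q t d) where
  Hom X Y := Hom q t d X.word Y.word
  id X := mk q t d (.one X.word)
  comp f g := comp f g
  id_comp := by rintro X Y ⟨f⟩; exact Quot.sound (.id_comp f)
  comp_id := by rintro X Y ⟨f⟩; exact Quot.sound (.comp_id f)
  assoc := by rintro W X Y Z ⟨f⟩ ⟨g⟩ ⟨h⟩; exact Quot.sound (.comp_assoc f g h)

instance : Preadditive (OSkein q t d) where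
  homGroup X Y := inferInstanceAs (AddCommGroup (Hom q t d X.word Y.word))
  add_comp := by rintro X Y Z ⟨f⟩ ⟨g⟩ ⟨h⟩; exact Quot.sound (.add_comp f g h)
  comp_add := by rintro X Y Z ⟨f⟩ ⟨g⟩ ⟨h⟩; exact Quot.sound (.comp_add f g h)

instance : Linear k (OSkein q t d) where
  homModule X Y := inferInstanceAs (Module k (Hom q t d X.word Y.word))
  smul_comp := by rintro X Y Z a ⟨f⟩ ⟨g⟩; exact Quot.sound (.smul_comp a f g)
  comp_smul := by rintro X Y Z ⟨f⟩ a ⟨g⟩; exact Quot.sound (.comp_smul a f g)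

/-- The morphism represented by an expression, between the objects given by two words. -/
def homMk (q t : kˣ) (d : k) {X Y : List Strand} (f : OSTerm k X Y) :
    (ofWord X : OSkein q t d) ⟶ ofWord Y := mk q t d f

theorem homMk_sound {X Y : List Strand} {f g : OSTerm k X Y} (h : OSRel q t d f g) :
    homMk q t d f = homMk q t d g := Quot.sound h

theorem homMk_cast {X Y X' Y' : List Strand} (hX : X = X') (hY : Y = Y') (f : OSTerm k X Y) :
    homMk q t d (f.cast hX hY) =
      eqToHom (congrArg ofWord hX.symm) ≫ homMk q t d f ≫ eqToHom (congrArg ofWord hY) := by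
  subst hX hY
  simp [OSTerm.cast]

/-- The tensor product of objects is the concatenation of words, the unit is the empty word, and
the associators and unitors are identities (of equal words). -/
instance : MonoidalCategoryStruct (OSkein q t d) where
  tensorObj X Y := ofWord (X.word ++ Y.word)
  tensorUnit := ofWord []
  tensorHom f g := tensor f g
  whiskerLeft X _ _ f := tensor (mk q t d (.one X.word)) f
  whiskerRight f Y := tensor f (mk q t d (.one Y.word))
  associator X Y Z := eqToIso (congrArg ofWord (List.append_assoc X.word Y.word Z.word))
  leftUnitor X := eqToIso (congrArg ofWord (List.nil_append X.word))
  rightUnitor X := eqToIso (congrArg ofWord (List.append_nil X.word))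

theorem associator_hom (X Y Z : OSkein q t d) : (MonoidalCategoryStruct.associator X Y Z).hom =
    eqToHom (congrArg ofWord (List.append_assoc X.word Y.word Z.word)) := rfl

theorem leftUnitor_hom (X : OSkein q t d) : (MonoidalCategoryStruct.leftUnitor X).hom = 𝟙 X := rfl

theorem rightUnitor_hom (X : OSkein q t d) : (MonoidalCategoryStruct.rightUnitor X).hom =
    eqToHom (congrArg ofWord (List.append_nil X.word)) := rfl

theorem id_tensorHom_id (X Y : OSkein q t d) : 𝟙 X ⊗ₘ 𝟙 Y = 𝟙 (X ⊗ Y) :=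
  homMk_sound (.id_tensor_id X.word Y.word)

theorem eqToHom_tensorHom_eqToHom {X Y X' Y' : OSkein q t d} (h : X = Y) (h' : X' = Y') :
    eqToHom h ⊗ₘ eqToHom h' = eqToHom (congrArg₂ (· ⊗ ·) h h') := by
  subst h h'
  exact id_tensorHom_id X X'

instance : MonoidalCategory (OSkein q t d) :=
  MonoidalCategory.ofTensorHom
    (id_tensorHom_id := id_tensorHom_id)
    (id_tensorHom := fun _ _ _ _ => rfl)
    (tensorHom_id := fun _ _ => rfl)
    (tensorHom_comp_tensorHom := by
      rintro X Y Z X' Y' Z' ⟨f⟩ ⟨f'⟩ ⟨g⟩ ⟨g'⟩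
      exact homMk_sound (.tensor_comp f g f' g'))
    (associator_naturality := by
      rintro X X' X'' Y Y' Y'' ⟨f⟩ ⟨g⟩ ⟨h⟩
      change homMk q t d ((f.tensor g).tensor h) ≫ (associator Y Y' Y'').hom =
        (associator X X' X'').hom ≫ homMk q t d (f.tensor (g.tensor h))
      rw [associator_hom, associator_hom, homMk_sound (.tensor_assoc f g h), homMk_cast]
      simp)
    (leftUnitor_naturality := by
      rintro X Y ⟨f⟩
      change homMk q t d ((OSTerm.one []).tensor f) ≫ 𝟙 Y = 𝟙 X ≫ homMk q t d f
      rw [homMk_sound (.unit_tensor f), Category.id_comp]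
      exact Category.comp_id (homMk q t d f))
    (rightUnitor_naturality := by
      rintro X Y ⟨f⟩
      change homMk q t d (f.tensor (OSTerm.one [])) ≫ (rightUnitor Y).hom =
        (rightUnitor X).hom ≫ homMk q t d f
      rw [rightUnitor_hom, rightUnitor_hom, homMk_sound (.tensor_unit f), homMk_cast]
      simp)
    (pentagon := by
      intro W X Y Z
      rw [← eqToHom_refl W rfl, ← eqToHom_refl Z rfl]
      simp only [associator_hom, eqToHom_tensorHom_eqToHom]
      simp)
    (triangle := by
      intro X Y
      rw [← eqToHom_refl X rfl, ← eqToHom_refl Y rfl]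
      simp only [associator_hom, rightUnitor_hom, leftUnitor_hom, ← eqToHom_refl Y rfl,
        eqToHom_tensorHom_eqToHom]
      simp)

theorem whiskerLeft_add (X : OSkein q t d) {Y Z : OSkein q t d} (f g : Y ⟶ Z) :
    X ◁ (f + g) = X ◁ f + X ◁ g := by
  rcases f with ⟨f⟩
  rcases g with ⟨g⟩
  exact homMk_sound (.tensor_add _ f g)

theorem add_whiskerRight {Y Z : OSkein q t d} (f g : Y ⟶ Z) (X : OSkein q t d) :
    (f + g) ▷ X = f ▷ X + g ▷ X := by
  rcases f with ⟨f⟩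
  rcases g with ⟨g⟩
  exact homMk_sound (.add_tensor f g _)

instance : MonoidalPreadditive (OSkein q t d) where
  whiskerLeft_zero {X Y Z} := by simpa using whiskerLeft_add X (0 : Y ⟶ Z) 0
  zero_whiskerRight {X Y Z} := by simpa using add_whiskerRight (0 : Y ⟶ Z) 0 X
  whiskerLeft_add := whiskerLeft_add _
  add_whiskerRight f g := add_whiskerRight f g _

instance : MonoidalLinear k (OSkein q t d) where
  whiskerLeft_smul := by
    rintro X Y Z a ⟨f⟩; exact homMk_sound (.tensor_smul a _ f)
  smul_whiskerRight := by
    rintro a Y Z ⟨f⟩ X; exact homMk_sound (.smul_tensor a f _)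

/-- The generating object `↑`. -/
def up (q t : kˣ) (d : k) : OSkein q t d := ofWord [Strand.up]

/-- The generating object `↓`. -/
def down (q t : kˣ) (d : k) : OSkein q t d := ofWord [Strand.down]

/-- The positive upward crossing. -/
def posCross (q t : kˣ) (d : k) : up q t d ⊗ up q t d ⟶ up q t d ⊗ up q t d :=
  homMk q t d (.gen OSGen.posCross)

/-- The negative upward crossing. -/
def negCross (q t : kˣ) (d : k) : up q t d ⊗ up q t d ⟶ up q t d ⊗ up q t d :=
  homMk q t d (.gen OSGen.negCross)

/-- The cup oriented from left to right. -/
def rightCup (q t : kˣ) (d : k) : 𝟙_ (OSkein q t d) ⟶ down q t d ⊗ up q t d :=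
  homMk q t d (.gen OSGen.rightCup)

/-- The cap oriented from left to right. -/
def rightCap (q t : kˣ) (d : k) : up q t d ⊗ down q t d ⟶ 𝟙_ (OSkein q t d) :=
  homMk q t d (.gen OSGen.rightCap)

/-- The cup oriented from right to left. -/
def leftCup (q t : kˣ) (d : k) : 𝟙_ (OSkein q t d) ⟶ up q t d ⊗ down q t d :=
  homMk q t d (.gen OSGen.leftCup)

/-- The cap oriented from right to left. -/
def leftCap (q t : kˣ) (d : k) : down q t d ⊗ up q t d ⟶ 𝟙_ (OSkein q t d) :=
  homMk q t d (.gen OSGen.leftCap)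

end OSkein

/-! ### The iquantum Brauer category -/

/-- The sign of an unoriented crossing: in a positive crossing the strand going from bottom left to
top right passes over the other one, in a negative crossing it passes under. -/
inductive CrossSign : Type
  | pos : CrossSign
  | neg : CrossSign

/-- The generating morphisms of the iquantum Brauer category: a cup or a cap on the left of `r`
strands, and a crossing of either sign with `r` strands on its left and `s = n - r - 2` strands
on its right. -/
inductive IQBGen : ℕ → ℕ → Type
  | cup (r : ℕ) : IQBGen r (r + 2)
  | cap (r : ℕ) : IQBGen (r + 2) r
  | cross (e : CrossSign) (r n : ℕ) (h : r + 2 ≤ n) : IQBGen n n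

/-- Formal expressions built from the generating morphisms by composition (in diagrammatic order)
and linear combination. -/
inductive IQBTerm (k : Type u) : ℕ → ℕ → Type u
  | gen {m n : ℕ} (g : IQBGen m n) : IQBTerm k m n
  | one (n : ℕ) : IQBTerm k n n
  | comp {l m n : ℕ} (f : IQBTerm k l m) (g : IQBTerm k m n) : IQBTerm k l n
  | zero (m n : ℕ) : IQBTerm k m n
  | add {m n : ℕ} (f g : IQBTerm k m n) : IQBTerm k m n
  | smul {m n : ℕ} (a : k) (f : IQBTerm k m n) : IQBTerm k m n

namespace IQBTerm

/-- The cup on the left of `r` strands. -/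
abbrev cup {k : Type u} (r : ℕ) : IQBTerm k r (r + 2) := gen (.cup r)

/-- The cap on the left of `r` strands. -/
abbrev cap {k : Type u} (r : ℕ) : IQBTerm k (r + 2) r := gen (.cap r)

/-- The positive crossing of `n` strands with `r` strands on its left. -/
abbrev pos {k : Type u} (r n : ℕ) (h : r + 2 ≤ n := by omega) : IQBTerm k n n :=
  gen (.cross .pos r n h)

/-- The negative crossing of `n` strands with `r` strands on its left. -/
abbrev neg {k : Type u} (r n : ℕ) (h : r + 2 ≤ n := by omega) : IQBTerm k n n :=
  gen (.cross .neg r n h)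

end IQBTerm

open IQBTerm in
/-- Equality of morphisms in the iquantum Brauer category: the smallest congruence on formal
expressions that contains the axioms of a `k`-linear category and the defining relations.
The scalar `d` is the value `(t - t⁻¹) / (q - q⁻¹)` of the bubble. -/
inductive IQBRel {k : Type u} [CommRing k] (q t : kˣ) (d : k) :
    ∀ {m n : ℕ}, IQBTerm k m n → IQBTerm k m n → Prop
  -- congruence
  | refl {m n : ℕ} (f : IQBTerm k m n) : IQBRel q t d f f
  | symm {m n : ℕ} {f g : IQBTerm k m n} : IQBRel q t d f g → IQBRel q t d g f
  | trans {m n : ℕ} {f g h : IQBTerm k m n} :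
      IQBRel q t d f g → IQBRel q t d g h → IQBRel q t d f h
  | comp_congr {l m n : ℕ} {f f' : IQBTerm k l m} {g g' : IQBTerm k m n} :
      IQBRel q t d f f' → IQBRel q t d g g' → IQBRel q t d (f.comp g) (f'.comp g')
  | add_congr {m n : ℕ} {f f' g g' : IQBTerm k m n} :
      IQBRel q t d f f' → IQBRel q t d g g' → IQBRel q t d (f.add g) (f'.add g')
  | smul_congr {m n : ℕ} (a : k) {f f' : IQBTerm k m n} :
      IQBRel q t d f f' → IQBRel q t d (f.smul a) (f'.smul a)
  -- category axioms
  | id_comp {m n : ℕ} (f : IQBTerm k m n) : IQBRel q t d ((one m).comp f) f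
  | comp_id {m n : ℕ} (f : IQBTerm k m n) : IQBRel q t d (f.comp (one n)) f
  | comp_assoc {l m n p : ℕ} (f : IQBTerm k l m) (g : IQBTerm k m n) (h : IQBTerm k n p) :
      IQBRel q t d ((f.comp g).comp h) (f.comp (g.comp h))
  -- module axioms
  | add_assoc {m n : ℕ} (f g h : IQBTerm k m n) :
      IQBRel q t d ((f.add g).add h) (f.add (g.add h))
  | add_comm {m n : ℕ} (f g : IQBTerm k m n) : IQBRel q t d (f.add g) (g.add f)
  | zero_add {m n : ℕ} (f : IQBTerm k m n) : IQBRel q t d ((zero m n).add f) f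
  | neg_add {m n : ℕ} (f : IQBTerm k m n) : IQBRel q t d ((f.smul (-1)).add f) (zero m n)
  | one_smul {m n : ℕ} (f : IQBTerm k m n) : IQBRel q t d (f.smul 1) f
  | mul_smul {m n : ℕ} (a b : k) (f : IQBTerm k m n) :
      IQBRel q t d (f.smul (a * b)) ((f.smul b).smul a)
  | smul_add {m n : ℕ} (a : k) (f g : IQBTerm k m n) :
      IQBRel q t d ((f.add g).smul a) ((f.smul a).add (g.smul a))
  | add_smul {m n : ℕ} (a b : k) (f : IQBTerm k m n) :
      IQBRel q t d (f.smul (a + b)) ((f.smul a).add (f.smul b))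
  -- bilinearity of the composition
  | add_comp {l m n : ℕ} (f f' : IQBTerm k l m) (g : IQBTerm k m n) :
      IQBRel q t d ((f.add f').comp g) ((f.comp g).add (f'.comp g))
  | comp_add {l m n : ℕ} (f : IQBTerm k l m) (g g' : IQBTerm k m n) :
      IQBRel q t d (f.comp (g.add g')) ((f.comp g).add (f.comp g'))
  | smul_comp {l m n : ℕ} (a : k) (f : IQBTerm k l m) (g : IQBTerm k m n) :
      IQBRel q t d ((f.smul a).comp g) ((f.comp g).smul a)
  | comp_smul {l m n : ℕ} (a : k) (f : IQBTerm k l m) (g : IQBTerm k m n) :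
      IQBRel q t d (f.comp (g.smul a)) ((f.comp g).smul a)
  -- braid relations
  | pos_neg (r n : ℕ) (h : r + 2 ≤ n) : IQBRel q t d ((pos r n).comp (neg r n)) (one n)
  | neg_pos (r n : ℕ) (h : r + 2 ≤ n) : IQBRel q t d ((neg r n).comp (pos r n)) (one n)
  | braid (r n : ℕ) (h : r + 3 ≤ n) :
      IQBRel q t d ((pos r n).comp ((pos (r + 1) n).comp (pos r n)))
        ((pos (r + 1) n).comp ((pos r n).comp (pos (r + 1) n)))
  -- skein relation
  | skein (r n : ℕ) (h : r + 2 ≤ n) :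
      IQBRel q t d ((pos r n).add ((neg r n).smul (-1)))
        ((one n).smul ((q : k) - (q⁻¹ : kˣ)))
  -- curls and bubble
  | curl (r : ℕ) :
      IQBRel q t d ((cup (r + 1)).comp ((pos 1 (r + 3)).comp (cap (r + 1))))
        ((one (r + 1)).smul (t : k))
  | curl_cap (r : ℕ) :
      IQBRel q t d ((pos 0 (r + 2)).comp (cap r)) ((cap r).smul (q : k))
  | curl_cup (r : ℕ) :
      IQBRel q t d ((cup r).comp (pos 0 (r + 2))) ((cup r).smul (q : k))
  | bubble (r : ℕ) : IQBRel q t d ((cup r).comp (cap r)) ((one r).smul d)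
  -- long-range cups and caps
  | hump (r : ℕ) :
      IQBRel q t d
        ((cup (r + 2)).comp ((neg 1 (r + 4)).comp ((neg 0 (r + 4)).comp
          ((pos 2 (r + 4)).comp ((pos 1 (r + 4)).comp (cap (r + 2)))))))
        ((cap r).comp (cup r))
  | hump_cap (r : ℕ) :
      IQBRel q t d
        ((neg 1 (r + 4)).comp ((neg 0 (r + 4)).comp ((pos 2 (r + 4)).comp
          ((pos 1 (r + 4)).comp ((cap (r + 2)).comp (cap r))))))
        ((cap (r + 2)).comp (cap r))
  | hump_cup (r : ℕ) :
      IQBRel q t d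
        ((cup r).comp ((cup (r + 2)).comp ((pos 1 (r + 4)).comp ((pos 2 (r + 4)).comp
          ((neg 0 (r + 4)).comp (neg 1 (r + 4)))))))
        ((cup r).comp (cup (r + 2)))
  -- a generating morphism commutes with the crossings on its right
  | cup_commute (e : CrossSign) (r n : ℕ) (h : r + 2 ≤ n) :
      IQBRel q t d ((gen (.cross e r n h)).comp (cup n))
        ((cup n).comp (gen (.cross e (r + 2) (n + 2) (by omega))))
  | cap_commute (e : CrossSign) (r n : ℕ) (h : r + 2 ≤ n) :
      IQBRel q t d ((gen (.cross e (r + 2) (n + 2) (by omega))).comp (cap n))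
        ((cap n).comp (gen (.cross e r n h)))
  | cross_commute (e e' : CrossSign) (r r' n : ℕ) (h : r + 2 ≤ r') (h' : r' + 2 ≤ n) :
      IQBRel q t d
        ((gen (.cross e' r' n h')).comp (gen (.cross e r n (by omega))))
        ((gen (.cross e r n (by omega))).comp (gen (.cross e' r' n h')))

/-- The iquantum Brauer category: it has one object `B r` for each natural number `r`. -/
structure IQBrauer {k : Type u} [CommRing k] (q t : kˣ) (d : k) : Type where
  /-- the object `B r` -/
  B ::
  /-- the number of strands -/
  strands : ℕ

namespace IQBrauer

variable {k : Type u} [CommRing k] {q t : kˣ} {d : k}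

/-- Morphisms are formal expressions up to `IQBRel`. -/
def Hom (q t : kˣ) (d : k) (m n : ℕ) : Type u :=
  Quot (IQBRel q t d (m := m) (n := n))

section

variable {l m n : ℕ}

/-- The morphism represented by an expression. -/
def mk (q t : kˣ) (d : k) (f : IQBTerm k m n) : Hom q t d m n := Quot.mk _ f

instance : Add (Hom q t d m n) where
  add := Quot.map₂ IQBTerm.add (fun _ _ _ h => .add_congr (.refl _) h)
    (fun _ _ _ h => .add_congr h (.refl _))

instance : Zero (Hom q t d m n) where
  zero := mk q t d (.zero m n)

instance : Neg (Hom q t d m n) where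
  neg := Quot.map (IQBTerm.smul (-1)) (fun _ _ h => .smul_congr _ h)

instance : AddCommGroup (Hom q t d m n) where
  add_assoc := by rintro ⟨f⟩ ⟨g⟩ ⟨h⟩; exact Quot.sound (.add_assoc f g h)
  add_comm := by rintro ⟨f⟩ ⟨g⟩; exact Quot.sound (.add_comm f g)
  zero_add := by rintro ⟨f⟩; exact Quot.sound (.zero_add f)
  add_zero := by rintro ⟨f⟩; exact Quot.sound (.trans (.add_comm _ _) (.zero_add f))
  neg_add_cancel := by rintro ⟨f⟩; exact Quot.sound (.neg_add f)
  nsmul := nsmulRec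
  zsmul := zsmulRec

instance : SMul k (Hom q t d m n) where
  smul a := Quot.map (IQBTerm.smul a) (fun _ _ h => .smul_congr a h)

instance : Module k (Hom q t d m n) :=
  Module.ofMinimalAxioms
    (by rintro a ⟨f⟩ ⟨g⟩; exact Quot.sound (.smul_add a f g))
    (by rintro a b ⟨f⟩; exact Quot.sound (.add_smul a b f))
    (by rintro a b ⟨f⟩; exact Quot.sound (.mul_smul a b f))
    (by rintro ⟨f⟩; exact Quot.sound (.one_smul f))

/-- Composition of morphisms, in diagrammatic order. -/
def comp : Hom q t d l m → Hom q t d m n → Hom q t d l n :=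
  Quot.map₂ IQBTerm.comp (fun _ _ _ h => .comp_congr (.refl _) h)
    (fun _ _ _ h => .comp_congr h (.refl _))

end

instance : Category.{u} (IQBrauer q t d) where
  Hom X Y := Hom q t d X.strands Y.strands
  id X := mk q t d (.one X.strands)
  comp f g := comp f g
  id_comp := by rintro m n ⟨f⟩; exact Quot.sound (.id_comp f)
  comp_id := by rintro m n ⟨f⟩; exact Quot.sound (.comp_id f)
  assoc := by rintro l m n p ⟨f⟩ ⟨g⟩ ⟨h⟩; exact Quot.sound (.comp_assoc f g h)

instance : Preadditive (IQBrauer q t d) where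
  homGroup X Y := inferInstanceAs (AddCommGroup (Hom q t d X.strands Y.strands))
  add_comp := by rintro l m n ⟨f⟩ ⟨g⟩ ⟨h⟩; exact Quot.sound (.add_comp f g h)
  comp_add := by rintro l m n ⟨f⟩ ⟨g⟩ ⟨h⟩; exact Quot.sound (.comp_add f g h)

instance : Linear k (IQBrauer q t d) where
  homModule X Y := inferInstanceAs (Module k (Hom q t d X.strands Y.strands))
  smul_comp := by rintro l m n a ⟨f⟩ ⟨g⟩; exact Quot.sound (.smul_comp a f g)
  comp_smul := by rintro l m n ⟨f⟩ a ⟨g⟩; exact Quot.sound (.comp_smul a f g)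

/-- The cup on the left of `r` strands. -/
def cup (q t : kˣ) (d : k) (r : ℕ) : (B r : IQBrauer q t d) ⟶ B (r + 2) := mk q t d (.cup r)

/-- The cap on the left of `r` strands. -/
def cap (q t : kˣ) (d : k) (r : ℕ) : (B (r + 2) : IQBrauer q t d) ⟶ B r := mk q t d (.cap r)

/-- The crossing of sign `e` of `n` strands with `r` strands on its left. -/
def cross (q t : kˣ) (d : k) (e : CrossSign) (r n : ℕ) (h : r + 2 ≤ n) :
    (B n : IQBrauer q t d) ⟶ B n := mk q t d (.gen (.cross e r n h))

/-! #### Adding one strand on the right -/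

/-- Adding one strand on the right of a generating morphism. -/
def genAddStrand : ∀ {m n : ℕ}, IQBGen m n → IQBGen (m + 1) (n + 1)
  | _, _, .cup r => .cup (r + 1)
  | _, _, .cap r => .cap (r + 1)
  | _, _, .cross e r n h => .cross e r (n + 1) (by omega)

/-- Adding one strand on the right of an expression. -/
def termAddStrand : ∀ {m n : ℕ}, IQBTerm k m n → IQBTerm k (m + 1) (n + 1)
  | _, _, .gen g => .gen (genAddStrand g)
  | _, _, .one n => .one (n + 1)
  | _, _, .comp f g => .comp (termAddStrand f) (termAddStrand g)
  | _, _, .zero m n => .zero (m + 1) (n + 1)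
  | _, _, .add f g => .add (termAddStrand f) (termAddStrand g)
  | _, _, .smul a f => .smul a (termAddStrand f)

theorem rel_termAddStrand {m n : ℕ} {f g : IQBTerm k m n} (h : IQBRel q t d f g) :
    IQBRel q t d (termAddStrand f) (termAddStrand g) := by
  induction h with
  | refl f => exact .refl _
  | symm _ ih => exact .symm ih
  | trans _ _ ih ih' => exact .trans ih ih'
  | comp_congr _ _ ih ih' => exact .comp_congr ih ih'
  | add_congr _ _ ih ih' => exact .add_congr ih ih'
  | smul_congr a _ ih => exact .smul_congr a ih
  | id_comp f => exact .id_comp _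
  | comp_id f => exact .comp_id _
  | comp_assoc f g h => exact .comp_assoc _ _ _
  | add_assoc f g h => exact .add_assoc _ _ _
  | add_comm f g => exact .add_comm _ _
  | zero_add f => exact .zero_add _
  | neg_add f => exact .neg_add _
  | one_smul f => exact .one_smul _
  | mul_smul a b f => exact .mul_smul a b _
  | smul_add a f g => exact .smul_add a _ _
  | add_smul a b f => exact .add_smul a b _
  | add_comp f f' g => exact .add_comp _ _ _
  | comp_add f g g' => exact .comp_add _ _ _
  | smul_comp a f g => exact .smul_comp a _ _
  | comp_smul a f g => exact .comp_smul a _ _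
  | pos_neg r n h => exact .pos_neg r (n + 1) (by omega)
  | neg_pos r n h => exact .neg_pos r (n + 1) (by omega)
  | braid r n h => exact .braid r (n + 1) (by omega)
  | skein r n h => exact .skein r (n + 1) (by omega)
  | curl r => exact .curl (r + 1)
  | curl_cap r => exact .curl_cap (r + 1)
  | curl_cup r => exact .curl_cup (r + 1)
  | bubble r => exact .bubble (r + 1)
  | hump r => exact .hump (r + 1)
  | hump_cap r => exact .hump_cap (r + 1)
  | hump_cup r => exact .hump_cup (r + 1)
  | cup_commute e r n h => exact .cup_commute e r (n + 1) (by omega)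
  | cap_commute e r n h => exact .cap_commute e r (n + 1) (by omega)
  | cross_commute e e' r r' n h h' => exact .cross_commute e e' r r' (n + 1) h (by omega)

/-- The endofunctor that adds one strand on the right: it sends `B r` to `B (r + 1)` and a
morphism `f` to `f` with one vertical strand on its right. -/
def addStrand (q t : kˣ) (d : k) : IQBrauer q t d ⥤ IQBrauer q t d where
  obj X := B (X.strands + 1)
  map := Quot.map termAddStrand (fun _ _ h => rel_termAddStrand h)
  map_id _ := rfl
  map_comp := by rintro l m n ⟨f⟩ ⟨g⟩; rfl

/-! #### The components of the natural transformations -/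

/-- The strand at position `i` (positions are counted from `0`) moves to position `i + s`, crossing
the `s` strands on its right, the remaining `n - s - 1` strands being vertical. All the crossings
have sign `e`; the strand passes over the `s` strands if `e` is positive, under them otherwise. -/
def moveRight (q t : kˣ) (d : k) (e : CrossSign) (i n : ℕ) :
    ∀ s : ℕ, i + s + 1 ≤ n → ((B n : IQBrauer q t d) ⟶ B n)
  | 0, _ => 𝟙 _
  | s + 1, h => moveRight q t d e i n s (by omega) ≫ cross q t d e (i + s) n (by omega)

/-- The strand at position `i + s` (positions are counted from `0`) moves to position `i`, crossing
the `s` strands on its left, the remaining `n - s - 1` strands being vertical. All the crossings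
have sign `e`; the strand passes under the `s` strands if `e` is positive, over them otherwise. -/
def moveLeft (q t : kˣ) (d : k) (e : CrossSign) (i n : ℕ) :
    ∀ s : ℕ, i + s + 1 ≤ n → ((B n : IQBrauer q t d) ⟶ B n)
  | 0, _ => 𝟙 _
  | s + 1, h => cross q t d e (i + s) n (by omega) ≫ moveLeft q t d e i n s (by omega)

/-- A cup is created on the left of `r` strands; its right end moves to the far right, over the
`r` strands; then its left end follows, under the `r` strands. -/
def rightCup (q t : kˣ) (d : k) (r : ℕ) : (B r : IQBrauer q t d) ⟶ B (r + 2) :=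
  cup q t d r ≫ moveRight q t d .pos 1 (r + 2) r (by omega) ≫
    moveRight q t d .neg 0 (r + 2) r (by omega)

/-- `q⁻¹ t` times the following: a cup is created on the left of `r` strands; its right end moves
to the far right, under the `r` strands; then its left end follows, over the `r` strands. -/
def leftCup (q t : kˣ) (d : k) (r : ℕ) : (B r : IQBrauer q t d) ⟶ B (r + 2) :=
  ((q⁻¹ * t : kˣ) : k) •
    (cup q t d r ≫ moveRight q t d .neg 1 (r + 2) r (by omega) ≫
      moveRight q t d .pos 0 (r + 2) r (by omega))

/-- The last but one strand moves to the far left, under `r` strands; then the last strand follows,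
over the `r` strands; then these two strands are closed by a cap. -/
def leftCap (q t : kˣ) (d : k) (r : ℕ) : (B (r + 2) : IQBrauer q t d) ⟶ B r :=
  moveLeft q t d .pos 0 (r + 2) r (by omega) ≫
    moveLeft q t d .neg 1 (r + 2) r (by omega) ≫ cap q t d r

/-- `q t⁻¹` times the following: the last but one strand moves to the far left, over `r` strands;
then the last strand follows, under the `r` strands; then these two strands are closed by a cap. -/
def rightCap (q t : kˣ) (d : k) (r : ℕ) : (B (r + 2) : IQBrauer q t d) ⟶ B r :=
  ((q * t⁻¹ : kˣ) : k) •
    (moveLeft q t d .neg 0 (r + 2) r (by omega) ≫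
      moveLeft q t d .pos 1 (r + 2) r (by omega) ≫ cap q t d r)

end IQBrauer

/-! A word in `↑` and `↓` must act by adding as many strands as it has letters, so only three things
need proof: the prescribed components are natural, they satisfy the relations of the oriented skein
category, and the action is strict.

Naturality has to be checked only against cups, caps and crossings (`natTransOfGen`). Up to scalars
the four long-range arcs are `cupMove` and `capMove` for a sign `e`. A crossing slides through both
strands of such an arc by the braid relation with arbitrary signs, which follows from the positive
one and the skein relation (`cross_cross_slide`, `moveRight_cross`). Against a cup or a cap, the two
strands cross both legs of the generator; the four crossings involved gather next to the innermost
arc, in a "hump". The three long-range relations of the iquantum Brauer category remove the hump,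
for one choice of signs each. The skein relation extends them to every sign that is needed
(`cup_hump_cap`, `cup_cup_hump`, `hump_cap_cap`); for the relation with one cup and one cap the
correction terms cancel because of `d (q - q⁻¹) = t - t⁻¹`.

For the relations, tensoring with an identity on the right adds strands to a component, and
tensoring on the left evaluates it at a larger object. Each relation involving arcs thus becomes an
identity between a `cupMove` and a `capMove` whose lengths differ by at most two, possibly with a
crossing in between. Sliding and cancelling inverse moves shrinks the diagram to a few crossings
near one cup and one cap, where `X_0` contributes powers of `q` and `X_1` a power of `t`
(`cupMove_zigzag`, `cupMove_curl_left`, `cupMove_curl_right`, `cupMove_cross_capMove` and the primed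
variants). In the zigzags and the sideways crossings a factor `q⁻¹ t` or its inverse remains, and
the scalars in the left cup and the right cap compensate it. In particular `ρ` and `λ` act as the
positive and the negative crossing, hence are mutually inverse.

Strictness holds because adding the strands of a concatenated word is the composite functor, up to
an equality of functors (`addWord_append`). -/

/-- The opposite sign. -/
def CrossSign.flip : CrossSign → CrossSign
  | .pos => .neg
  | .neg => .pos

@[simp] theorem CrossSign.flip_flip (e : CrossSign) : e.flip.flip = e := by cases e <;> rfl

namespace IQBrauer

variable {k : Type u} [CommRing k] {q t : kˣ} {d : k}

/-! ### Basic relations between crossings, cups and caps -/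

section Relations

theorem cross_flip (e : CrossSign) (i n : ℕ) (h : i + 2 ≤ n) :
    cross q t d e i n h ≫ cross q t d e.flip i n h = 𝟙 _ := by
  cases e
  · exact Quot.sound (.pos_neg i n h)
  · exact Quot.sound (.neg_pos i n h)

theorem cross_flip_assoc (e : CrossSign) (i n : ℕ) (h : i + 2 ≤ n) {Z : IQBrauer q t d}
    (f : B n ⟶ Z) : cross q t d e i n h ≫ cross q t d e.flip i n h ≫ f = f := by
  rw [← Category.assoc, cross_flip, Category.id_comp]

theorem flip_cross (e : CrossSign) (i n : ℕ) (h : i + 2 ≤ n) :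
    cross q t d e.flip i n h ≫ cross q t d e i n h = 𝟙 _ := by
  simpa using cross_flip (q := q) (t := t) (d := d) e.flip i n h

theorem flip_cross_assoc (e : CrossSign) (i n : ℕ) (h : i + 2 ≤ n) {Z : IQBrauer q t d}
    (f : B n ⟶ Z) : cross q t d e.flip i n h ≫ cross q t d e i n h ≫ f = f := by
  rw [← Category.assoc, flip_cross, Category.id_comp]

/-- A crossing, as an isomorphism. -/
def crossIso (q t : kˣ) (d : k) (e : CrossSign) (i n : ℕ) (h : i + 2 ≤ n) :
    (B n : IQBrauer q t d) ≅ B n where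
  hom := cross q t d e i n h
  inv := cross q t d e.flip i n h
  hom_inv_id := cross_flip e i n h
  inv_hom_id := flip_cross e i n h

/-- Distant crossings commute. -/
theorem cross_comm (e e' : CrossSign) (i j n : ℕ) (hi : i + 2 ≤ n) (hj : j + 2 ≤ n)
    (h : i + 2 ≤ j) :
    cross q t d e' j n hj ≫ cross q t d e i n hi = cross q t d e i n hi ≫ cross q t d e' j n hj :=
  Quot.sound (.cross_commute e e' i j n h hj)

theorem cross_braid_pos (i n : ℕ) (h : i + 3 ≤ n) :
    cross q t d .pos i n (by omega) ≫ cross q t d .pos (i + 1) n (by omega) ≫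
        cross q t d .pos i n (by omega) =
      cross q t d .pos (i + 1) n (by omega) ≫ cross q t d .pos i n (by omega) ≫
        cross q t d .pos (i + 1) n (by omega) :=
  Quot.sound (.braid i n h)

theorem cross_pos (i n : ℕ) (h : i + 2 ≤ n) :
    cross q t d .pos i n h = cross q t d .neg i n h + ((q : k) - (q⁻¹ : kˣ)) • 𝟙 _ := by
  have hs : cross q t d .pos i n h + (-1 : k) • cross q t d .neg i n h =
      ((q : k) - (q⁻¹ : kˣ)) • 𝟙 _ := Quot.sound (.skein i n h)
  rw [← hs]
  simp

theorem cross_neg (i n : ℕ) (h : i + 2 ≤ n) :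
    cross q t d .neg i n h = cross q t d .pos i n h - ((q : k) - (q⁻¹ : kˣ)) • 𝟙 _ := by
  rw [cross_pos]; simp

/-- By the skein relation, changing the sign of a crossing adds a multiple of the identity, and that
multiple slides along every endomorphism `f`. Sliding relations therefore need proof for one sign
only. -/
theorem cross_slide_of_slide {e e' : CrossSign} {n i j : ℕ} {hi : i + 2 ≤ n} {hj : j + 2 ≤ n}
    {f : (B n : IQBrauer q t d) ⟶ B n}
    (h : f ≫ cross q t d e i n hi = cross q t d e j n hj ≫ f) :
    f ≫ cross q t d e' i n hi = cross q t d e' j n hj ≫ f := by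
  cases e <;> cases e'
  · exact h
  · rw [cross_neg, cross_neg, Preadditive.comp_sub, Preadditive.sub_comp, h]
    simp
  · rw [cross_pos, cross_pos, Preadditive.comp_add, Preadditive.add_comp, h]
    simp
  · exact h

theorem inv_slide {C : Type*} [Category C] {X Y : C} (a : X ≅ Y) {f : X ⟶ X} {g : Y ⟶ Y}
    (h : a.hom ≫ g = f ≫ a.hom) : a.inv ≫ f = g ≫ a.inv := by
  rw [Iso.inv_comp_eq, ← Category.assoc, h]; simp

/-- The braid relation with arbitrary signs, in the form: a pair of crossings of equal sign
slides along a crossing. -/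
theorem cross_cross_slide (e e' : CrossSign) (i j n : ℕ) (h : j + 2 ≤ n) (hj : j = i + 1) :
    (cross q t d e i n (by omega) ≫ cross q t d e j n h) ≫ cross q t d e' i n (by omega) =
      cross q t d e' j n h ≫ cross q t d e i n (by omega) ≫ cross q t d e j n h := by
  subst hj
  apply cross_slide_of_slide (e := .pos)
  cases e
  · rw [Category.assoc, cross_braid_pos _ _ (by omega)]
  · have hb : (cross q t d .pos (i + 1) n h ≫ cross q t d .pos i n (by omega)) ≫
        cross q t d .pos (i + 1) n (by omega) = cross q t d .pos i n (by omega) ≫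
        cross q t d .pos (i + 1) n (by omega) ≫ cross q t d .pos i n (by omega) := by
      rw [Category.assoc, cross_braid_pos _ _ (by omega)]
    -- The pair of negative crossings is the inverse of the positive pair in the opposite order, so
    -- the positive braid relation is inverted.
    exact inv_slide (crossIso q t d .pos (i + 1) n h ≪≫ crossIso q t d .pos i n (by omega)) hb

/-- The shifted position is a variable `j` with an equation, so that rewriting also applies to
positions that are not syntactically of the form `i + 2`. The same device is used in the lemmas
below. -/
theorem cap_comm (e : CrossSign) (i j n : ℕ) (h : i + 2 ≤ n) (hj' : j + 2 ≤ n + 2)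
    (hj : j = i + 2) :
    cross q t d e j (n + 2) hj' ≫ cap q t d n = cap q t d n ≫ cross q t d e i n h := by
  subst hj
  exact Quot.sound (.cap_commute e i n h)

theorem cup_comm (e : CrossSign) (i j n : ℕ) (h : i + 2 ≤ n) (hj' : j + 2 ≤ n + 2)
    (hj : j = i + 2) :
    cup q t d n ≫ cross q t d e j (n + 2) hj' = cross q t d e i n h ≫ cup q t d n := by
  subst hj
  exact (Quot.sound (.cup_commute e i n h)).symm

end Relations

/-! ### Sequences of crossings -/

section Move

variable (e e' : CrossSign)

/-- The recursion of `moveRight` splits off the last crossing; next to a cup it is the first one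
that must be split off. -/
theorem moveRight_succ_left (i j n s : ℕ) (h : i + (s + 1) + 1 ≤ n) (hj : j = i + 1) :
    moveRight q t d e i n (s + 1) h =
      cross q t d e i n (by omega) ≫ moveRight q t d e j n s (by omega) := by
  subst hj
  induction s with
  | zero => simp [moveRight]
  | succ s ih =>
    rw [moveRight, ih (by omega), Category.assoc]
    conv_rhs => rw [moveRight]
    simp only [Nat.add_right_comm i 1 s, Nat.add_assoc]

theorem moveLeft_succ_right (i j n s : ℕ) (h : i + (s + 1) + 1 ≤ n) (hj : j = i + 1) :
    moveLeft q t d e i n (s + 1) h =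
      moveLeft q t d e j n s (by omega) ≫ cross q t d e i n (by omega) := by
  subst hj
  induction s with
  | zero => simp [moveLeft]
  | succ s ih =>
    rw [moveLeft, ih (by omega), ← Category.assoc]
    conv_rhs => rw [moveLeft]
    simp only [Nat.add_right_comm i 1 s, Nat.add_assoc]

theorem moveRight_moveLeft_flip (i n s : ℕ) (h : i + s + 1 ≤ n) :
    moveRight q t d e i n s h ≫ moveLeft q t d e.flip i n s h = 𝟙 _ := by
  induction s with
  | zero => simp [moveRight, moveLeft]
  | succ s ih => simp [moveRight, moveLeft, cross_flip_assoc, ih]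

theorem moveLeft_flip_moveRight (i n s : ℕ) (h : i + s + 1 ≤ n) :
    moveLeft q t d e.flip i n s h ≫ moveRight q t d e i n s h = 𝟙 _ := by
  induction s with
  | zero => simp [moveRight, moveLeft]
  | succ s ih =>
    simp only [moveRight, moveLeft, Category.assoc]
    rw [← Category.assoc (moveLeft q t d e.flip i n s _), ih, Category.id_comp, flip_cross]

/-- Moving a strand to the right, as an isomorphism. -/
def moveRightIso (q t : kˣ) (d : k) (e : CrossSign) (i n s : ℕ) (h : i + s + 1 ≤ n) :
    (B n : IQBrauer q t d) ≅ B n where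
  hom := moveRight q t d e i n s h
  inv := moveLeft q t d e.flip i n s h
  hom_inv_id := moveRight_moveLeft_flip e i n s h
  inv_hom_id := moveLeft_flip_moveRight e i n s h

/-- A sequence of crossings commutes with the crossings on its right. -/
theorem moveRight_comm_right (i j n s : ℕ) (h : i + s + 1 ≤ n) (hj : j + 2 ≤ n)
    (hij : i + s + 1 ≤ j) :
    moveRight q t d e i n s h ≫ cross q t d e' j n hj =
      cross q t d e' j n hj ≫ moveRight q t d e i n s h := by
  induction s with
  | zero => simp [moveRight]
  | succ s ih =>
    rw [moveRight, Category.assoc, ← cross_comm _ _ _ _ _ _ _ (by omega),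
      reassoc_of% ih (by omega) (by omega)]

/-- A sequence of crossings commutes with the crossings on its left. -/
theorem moveRight_comm_left (i j n s : ℕ) (h : i + s + 1 ≤ n) (hj : j + 2 ≤ n)
    (hij : j + 2 ≤ i) :
    moveRight q t d e i n s h ≫ cross q t d e' j n hj =
      cross q t d e' j n hj ≫ moveRight q t d e i n s h := by
  induction s with
  | zero => simp [moveRight]
  | succ s ih =>
    rw [moveRight, Category.assoc, cross_comm _ _ _ _ _ _ _ (by omega), reassoc_of% ih (by omega)]

/-- A crossing slides along a strand that moves to the right. -/
theorem moveRight_cross (i j l n s : ℕ) (h : i + s + 1 ≤ n) (hl : l + 2 ≤ n)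
    (hj : j = l + 1) (hil : i ≤ l) (hls : l + 2 ≤ i + s) :
    moveRight q t d e i n s h ≫ cross q t d e' l n hl =
      cross q t d e' j n (by omega) ≫ moveRight q t d e i n s h := by
  induction s with
  | zero => omega
  | succ s ih =>
    rw [moveRight, Category.assoc]
    -- Either the crossing is far from the last crossing of the move, at `i + s`, and commutes with
    -- it, or it is its left neighbour. In the second case the braid relation applies to it and the
    -- last two crossings of the move, and the result lies to the right of all the remaining ones.
    obtain hls | hls := Nat.lt_or_ge l (i + s - 1)
    · rw [cross_comm _ _ _ _ _ _ _ (by omega), reassoc_of% ih (by omega) (by omega)]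
    · obtain ⟨s, rfl⟩ : ∃ s', s = s' + 1 := ⟨s - 1, by omega⟩
      obtain rfl : l = i + s := by omega
      have := cross_cross_slide (q := q) (t := t) (d := d) e e' (i + s) (i + (s + 1)) n
        (by omega) (by omega)
      rw [Category.assoc] at this
      obtain rfl : j = i + (s + 1) := by omega
      rw [moveRight, Category.assoc, this,
        reassoc_of% moveRight_comm_right _ _ _ _ _ _ _ (by omega) (by omega)]
      simp only [Category.assoc]

/-- A crossing slides along a strand that moves to the left. -/
theorem cross_moveLeft (i j l n s : ℕ) (h : i + s + 1 ≤ n) (hl : l + 2 ≤ n)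
    (hj : j = l + 1) (hil : i ≤ l) (hls : l + 2 ≤ i + s) :
    cross q t d e' l n hl ≫ moveLeft q t d e i n s h =
      moveLeft q t d e i n s h ≫ cross q t d e' j n (by omega) := by
  have := inv_slide (moveRightIso q t d e.flip i n s h)
    (moveRight_cross e.flip e' i j l n s h hl hj hil hls)
  simpa [moveRightIso] using this.symm

/-- A sequence of crossings commutes with the crossings on its right. -/
theorem moveLeft_comm_right (i j n s : ℕ) (h : i + s + 1 ≤ n) (hj : j + 2 ≤ n)
    (hij : i + s + 1 ≤ j) :
    moveLeft q t d e i n s h ≫ cross q t d e' j n hj =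
      cross q t d e' j n hj ≫ moveLeft q t d e i n s h := by
  have := inv_slide (moveRightIso q t d e.flip i n s h)
    (moveRight_comm_right e.flip e' i j n s h hj hij)
  simpa [moveRightIso] using this

/-- A sequence of crossings commutes with the crossings on its left. -/
theorem moveLeft_comm_left (i j n s : ℕ) (h : i + s + 1 ≤ n) (hj : j + 2 ≤ n)
    (hij : j + 2 ≤ i) :
    moveLeft q t d e i n s h ≫ cross q t d e' j n hj =
      cross q t d e' j n hj ≫ moveLeft q t d e i n s h := by
  have := inv_slide (moveRightIso q t d e.flip i n s h)
    (moveRight_comm_left e.flip e' i j n s h hj hij)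
  simpa [moveRightIso] using this

/-- Since `s < r`, every crossing of the shorter move lies within the range of the longer one, so
all of them slide along it and are shifted by one place. -/
theorem moveRight_moveLeft (i j n s r : ℕ) (h : i + r + 1 ≤ n) (hs : s + 1 ≤ r)
    (hj : j = i + 1) :
    moveRight q t d e i n r h ≫ moveLeft q t d e' i n s (by omega) =
      moveLeft q t d e' j n s (by omega) ≫ moveRight q t d e i n r h := by
  induction s with
  | zero => simp [moveLeft]
  | succ s ih =>
    rw [moveLeft,
      reassoc_of% moveRight_cross _ _ _ (j + s) _ _ _ _ _ (by omega) (by omega) (by omega),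
      ih (by omega), moveLeft, Category.assoc]

theorem moveRight_moveLeft' (i j n s r : ℕ) (h : i + r + 1 ≤ n) (hs : s + 1 ≤ r)
    (hj : j = i + 1) :
    moveRight q t d e i n s (by omega) ≫ moveLeft q t d e' i n r h =
      moveLeft q t d e' i n r h ≫ moveRight q t d e j n s (by omega) := by
  induction s with
  | zero => simp [moveRight]
  | succ s ih =>
    rw [moveRight, Category.assoc,
      cross_moveLeft _ _ _ (j + s) _ _ _ _ _ (by omega) (by omega) (by omega),
      reassoc_of% ih (by omega), moveRight]

/-! ### Sequences of crossings past a cup or a cap -/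

theorem cup_moveRight (i j n s : ℕ) (h : i + s + 1 ≤ n) (h' : j + s + 1 ≤ n + 2)
    (hj : j = i + 2) :
    cup q t d n ≫ moveRight q t d e j (n + 2) s h' = moveRight q t d e i n s h ≫ cup q t d n := by
  induction s with
  | zero => simp [moveRight]
  | succ s ih =>
    rw [moveRight, reassoc_of% ih (by omega) (by omega),
      cup_comm e (i + s) _ _ (by omega) _ (by omega), moveRight, Category.assoc]

theorem cup_moveLeft (i j n s : ℕ) (h : i + s + 1 ≤ n) (h' : j + s + 1 ≤ n + 2)
    (hj : j = i + 2) :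
    cup q t d n ≫ moveLeft q t d e j (n + 2) s h' = moveLeft q t d e i n s h ≫ cup q t d n := by
  induction s with
  | zero => simp [moveLeft]
  | succ s ih =>
    rw [moveLeft, reassoc_of% cup_comm e (i + s) _ _ (by omega) _ (by omega),
      ih (by omega) (by omega),
      moveLeft, Category.assoc]

theorem moveRight_cap (i j n s : ℕ) (h : i + s + 1 ≤ n) (h' : j + s + 1 ≤ n + 2)
    (hj : j = i + 2) :
    moveRight q t d e j (n + 2) s h' ≫ cap q t d n = cap q t d n ≫ moveRight q t d e i n s h := by
  induction s with
  | zero => simp [moveRight]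
  | succ s ih =>
    rw [moveRight, Category.assoc, cap_comm e (i + s) _ _ (by omega) _ (by omega),
      reassoc_of% ih (by omega) (by omega), moveRight]

theorem moveLeft_cap (i j n s : ℕ) (h : i + s + 1 ≤ n) (h' : j + s + 1 ≤ n + 2)
    (hj : j = i + 2) :
    moveLeft q t d e j (n + 2) s h' ≫ cap q t d n = cap q t d n ≫ moveLeft q t d e i n s h := by
  induction s with
  | zero => simp [moveLeft]
  | succ s ih =>
    rw [moveLeft, Category.assoc, ih (by omega) (by omega),
      reassoc_of% cap_comm e (i + s) _ _ (by omega) _ (by omega), moveLeft]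

end Move

end IQBrauer

/-! ### Signs as exponents -/

/-- The power of a unit with exponent `1` or `-1`. -/
def CrossSign.unitPow {M : Type*} [Monoid M] (x : Mˣ) : CrossSign → Mˣ
  | .pos => x
  | .neg => x⁻¹

@[simp] theorem CrossSign.unitPow_pos {M : Type*} [Monoid M] (x : Mˣ) :
    CrossSign.pos.unitPow x = x := rfl

@[simp] theorem CrossSign.unitPow_neg {M : Type*} [Monoid M] (x : Mˣ) :
    CrossSign.neg.unitPow x = x⁻¹ := rfl

@[simp] theorem CrossSign.flip_pos : CrossSign.pos.flip = .neg := rfl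

@[simp] theorem CrossSign.flip_neg : CrossSign.neg.flip = .pos := rfl

@[simp] theorem CrossSign.unitPow_flip {M : Type*} [Monoid M] (x : Mˣ) (e : CrossSign) :
    e.flip.unitPow x = (e.unitPow x)⁻¹ := by
  cases e <;> simp

namespace IQBrauer

variable {k : Type u} [CommRing k] {q t : kˣ} {d : k}

/-! ### Crossings next to cups and caps -/

section CupCap

theorem pos_comp_neg (i n : ℕ) (h : i + 2 ≤ n) :
    cross q t d .pos i n h ≫ cross q t d .neg i n h = 𝟙 _ := cross_flip .pos i n h

theorem neg_comp_pos (i n : ℕ) (h : i + 2 ≤ n) :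
    cross q t d .neg i n h ≫ cross q t d .pos i n h = 𝟙 _ := cross_flip .neg i n h

/-- A rearranged braid relation: a conjugation by one neighbour is traded for a conjugation by the
other. It is used to put the outer crossings where a cup or a cap absorbs them or lets them pass. -/
theorem cross_conj (e e' : CrossSign) (i j n : ℕ) (h : j + 2 ≤ n) (hj : j = i + 1) :
    cross q t d e j n h ≫ cross q t d e' i n (by omega) ≫ cross q t d e.flip j n h =
      cross q t d e.flip i n (by omega) ≫ cross q t d e' j n h ≫ cross q t d e i n (by omega) := by
  have := cross_cross_slide (q := q) (t := t) (d := d) e e' i j n h hj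
  rw [Category.assoc] at this
  rw [← cancel_epi (crossIso q t d e i n (by omega)).hom,
    ← cancel_mono (crossIso q t d e j n h).hom]
  change (cross q t d e i n _ ≫ _) ≫ cross q t d e j n h =
    (cross q t d e i n _ ≫ _) ≫ cross q t d e j n h
  simp only [Category.assoc, cross_flip_assoc]
  rw [flip_cross, Category.comp_id, this]

variable (r : ℕ)

theorem cup_cap : cup q t d r ≫ cap q t d r = d • 𝟙 _ := Quot.sound (.bubble r)

theorem cross_zero_cap (e : CrossSign) (h : 0 + 2 ≤ r + 2) :
    cross q t d e 0 (r + 2) h ≫ cap q t d r = ((e.unitPow q : kˣ) : k) • cap q t d r := by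
  have hp : cross q t d .pos 0 (r + 2) h ≫ cap q t d r = (q : k) • cap q t d r :=
    Quot.sound (.curl_cap r)
  cases e
  · exact hp
  · have h := flip_cross_assoc (q := q) (t := t) (d := d) .pos 0 (r + 2) h (cap q t d r)
    rw [hp, Linear.comp_smul] at h
    conv_rhs => rw [← h]
    simp [smul_smul]

theorem cup_cross_zero (e : CrossSign) (h : 0 + 2 ≤ r + 2) :
    cup q t d r ≫ cross q t d e 0 (r + 2) h = ((e.unitPow q : kˣ) : k) • cup q t d r := by
  have hp : cup q t d r ≫ cross q t d .pos 0 (r + 2) h = (q : k) • cup q t d r :=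
    Quot.sound (.curl_cup r)
  cases e
  · exact hp
  · have h : cup q t d r ≫ _ = _ := congrArg (cup q t d r ≫ ·)
      (cross_flip (q := q) (t := t) (d := d) .pos 0 (r + 2) h)
    rw [← Category.assoc, hp, Linear.smul_comp, Category.comp_id] at h
    conv_rhs => rw [← h]
    simp [smul_smul]

/-- For the negative sign, the skein relation and the bubble give `t - (q - q⁻¹) d`, which is `t⁻¹`
by `hd`. -/
theorem cup_cross_cap (hd : d * ((q : k) - (q⁻¹ : kˣ)) = (t : k) - (t⁻¹ : kˣ))
    (e : CrossSign) (h : 1 + 2 ≤ r + 2) :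
    cup q t d r ≫ cross q t d e 1 (r + 2) h ≫ cap q t d r =
      ((e.unitPow t : kˣ) : k) • 𝟙 _ := by
  have hp : cup q t d r ≫ cross q t d .pos 1 (r + 2) h ≫ cap q t d r = (t : k) • 𝟙 _ := by
    obtain ⟨r, rfl⟩ : ∃ s, r = s + 1 := ⟨r - 1, by omega⟩
    exact Quot.sound (.curl r)
  cases e
  · exact hp
  · rw [cross_neg, Preadditive.sub_comp, Preadditive.comp_sub, hp]
    simp only [Linear.smul_comp, Category.id_comp, Linear.comp_smul, cup_cap, smul_smul,
      ← sub_smul]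
    congr 1
    simp only [CrossSign.unitPow_neg]
    linear_combination -hd

theorem cup_cross_cap_assoc (hd : d * ((q : k) - (q⁻¹ : kˣ)) = (t : k) - (t⁻¹ : kˣ))
    (e : CrossSign) (h : 1 + 2 ≤ r + 2) {Z : IQBrauer q t d} (f : B r ⟶ Z) :
    cup q t d r ≫ cross q t d e 1 (r + 2) h ≫ cap q t d r ≫ f =
      ((e.unitPow t : kˣ) : k) • f := by
  rw [← Category.assoc (cross _ _ _ _ _ _ _), ← Category.assoc (cup _ _ _ _),
    cup_cross_cap r hd e h]
  simp

/-! ### The long-range relations with other signs -/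

/-- The negative sign is the defining relation. For the positive sign, both outer crossings are
replaced using the skein relation. The three correction terms `h₁`, `h₂`, `h₃` are multiples of the
same crossing `X_0^+`. -/
theorem cup_cross_neg_pos_cross_cap
    (hd : d * ((q : k) - (q⁻¹ : kˣ)) = (t : k) - (t⁻¹ : kˣ)) (e : CrossSign) :
    cup q t d (r + 2) ≫ cross q t d e 1 (r + 2 + 2) (by omega) ≫
        cross q t d .neg 0 (r + 2 + 2) (by omega) ≫ cross q t d .pos 2 (r + 2 + 2) (by omega) ≫
        cross q t d e.flip 1 (r + 2 + 2) (by omega) ≫ cap q t d (r + 2) =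
      cap q t d r ≫ cup q t d r := by
  have h₀ : cup q t d (r + 2) ≫ cross q t d .neg 1 (r + 2 + 2) (by omega) ≫
        cross q t d .neg 0 (r + 2 + 2) (by omega) ≫ cross q t d .pos 2 (r + 2 + 2) (by omega) ≫
        cross q t d .pos 1 (r + 2 + 2) (by omega) ≫ cap q t d (r + 2) =
      cap q t d r ≫ cup q t d r := Quot.sound (.hump r)
  cases e
  · have h₁ : cup q t d (r + 2) ≫ cross q t d .neg 1 (r + 2 + 2) (by omega) ≫
          cross q t d .neg 0 (r + 2 + 2) (by omega) ≫ cross q t d .pos 2 (r + 2 + 2) (by omega) ≫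
          cap q t d (r + 2) =
        ((q⁻¹ * t⁻¹ : kˣ) : k) • cross q t d .pos 0 (r + 2) (by omega) := by
      rw [← reassoc_of% cross_comm .neg .pos 0 2 _ _ _ (by omega), cross_zero_cap,
        Linear.comp_smul, cap_comm _ 0 _ _ (by omega) _ rfl, Linear.comp_smul, Linear.comp_smul,
        cup_cross_cap_assoc _ hd, smul_smul]
      simp
    have h₂ : cup q t d (r + 2) ≫ cross q t d .neg 0 (r + 2 + 2) (by omega) ≫
          cross q t d .pos 2 (r + 2 + 2) (by omega) ≫ cross q t d .pos 1 (r + 2 + 2) (by omega) ≫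
          cap q t d (r + 2) =
        ((q⁻¹ * t : kˣ) : k) • cross q t d .pos 0 (r + 2) (by omega) := by
      rw [reassoc_of% cup_cross_zero, Linear.smul_comp,
        reassoc_of% cup_comm _ 0 _ _ (by omega) _ rfl,
        cup_cross_cap _ hd, Linear.comp_smul, smul_smul, Category.comp_id]
      simp
    have h₃ : cup q t d (r + 2) ≫ cross q t d .neg 0 (r + 2 + 2) (by omega) ≫
          cross q t d .pos 2 (r + 2 + 2) (by omega) ≫ cap q t d (r + 2) =
        (((q⁻¹ : kˣ) : k) * d) • cross q t d .pos 0 (r + 2) (by omega) := by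
      rw [reassoc_of% cup_cross_zero, Linear.smul_comp,
        reassoc_of% cup_comm _ 0 _ _ (by omega) _ rfl,
        cup_cap, Linear.comp_smul, smul_smul, Category.comp_id]
      simp
    rw [CrossSign.flip_pos, cross_neg 1, ← h₀]
    nth_rewrite 1 [cross_pos 1]
    simp only [Preadditive.add_comp, Preadditive.comp_add, Preadditive.sub_comp,
      Preadditive.comp_sub, Linear.smul_comp, Linear.comp_smul, Category.id_comp, h₁, h₂, h₃,
      smul_smul]
    -- The total coefficient of `X_0^+`: with `z = q - q⁻¹` it equals `z q⁻¹ (t - t⁻¹ - z d)`.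
    have hz : ((q : k) - (q⁻¹ : kˣ)) * ((q⁻¹ * t : kˣ) : k) -
        ((q : k) - (q⁻¹ : kˣ)) * ((q⁻¹ * t⁻¹ : kˣ) : k) -
        ((q : k) - (q⁻¹ : kˣ)) * (((q : k) - (q⁻¹ : kˣ)) * (((q⁻¹ : kˣ) : k) * d)) = 0 := by
      simp only [Units.val_mul]
      linear_combination (-((q : k) - (q⁻¹ : kˣ)) * (q⁻¹ : kˣ)) * hd
    linear_combination (norm := module) (hz) • cross q t d .pos 0 (r + 2) (by omega)
  · exact h₀

/-- Exchanging the signs of the middle crossings changes the diagram by `q - q⁻¹` times a difference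
of two diagrams, each with only one of the two middle crossings. These agree, because with a
positive middle crossing both have the value `t`: for `X_0` the conjugating crossings are absorbed
by the cup and the cap, for `X_2` they pass them and cancel. -/
theorem cup_cross_pos_neg_cross_cap
    (hd : d * ((q : k) - (q⁻¹ : kˣ)) = (t : k) - (t⁻¹ : kˣ)) (e : CrossSign) :
    cup q t d (r + 2) ≫ cross q t d e 1 (r + 2 + 2) (by omega) ≫
        cross q t d .pos 0 (r + 2 + 2) (by omega) ≫ cross q t d .neg 2 (r + 2 + 2) (by omega) ≫
        cross q t d e.flip 1 (r + 2 + 2) (by omega) ≫ cap q t d (r + 2) =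
      cap q t d r ≫ cup q t d r := by
  have h₁ : cup q t d (r + 2) ≫ cross q t d e 1 (r + 2 + 2) (by omega) ≫
      cross q t d .pos 0 (r + 2 + 2) (by omega) ≫
        cross q t d e.flip 1 (r + 2 + 2) (by omega) ≫ cap q t d (r + 2) = (t : k) • 𝟙 _ := by
    rw [reassoc_of% cross_conj _ _ 0 1 _ _ rfl, reassoc_of% cup_cross_zero, cross_zero_cap]
    simp [cup_cross_cap _ hd, smul_smul]
  have h₂ : cup q t d (r + 2) ≫ cross q t d e 1 (r + 2 + 2) (by omega) ≫
      cross q t d .pos 2 (r + 2 + 2) (by omega) ≫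
        cross q t d e.flip 1 (r + 2 + 2) (by omega) ≫ cap q t d (r + 2) = (t : k) • 𝟙 _ := by
    have := cross_conj e.flip .pos 1 2 (r + 2 + 2) (by omega) rfl =≫ cap q t d (r + 2)
    simp only [CrossSign.flip_flip, Category.assoc] at this
    rw [← this, reassoc_of% cup_comm _ 0 _ _ (by omega) _ rfl, cap_comm _ 0 _ _ (by omega) _ rfl,
      cup_cross_cap_assoc _ hd]
    simp [flip_cross]
  rw [← cup_cross_neg_pos_cross_cap r hd e, cross_pos 0, cross_pos 2] at *
  simp only [Preadditive.add_comp, Preadditive.comp_add, Linear.smul_comp, Linear.comp_smul,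
    Category.id_comp] at *
  linear_combination (norm := module) ((q : k) - (q⁻¹ : kˣ)) • (h₂ - h₁)

/-- The two signs are independent because a long-range cup meeting a cap produces `e' = e.flip`,
whereas a cup meeting a long-range cap produces `e' = e`. -/
theorem cup_hump_cap (hd : d * ((q : k) - (q⁻¹ : kˣ)) = (t : k) - (t⁻¹ : kˣ)) (e e' : CrossSign) :
    cup q t d (r + 2) ≫ cross q t d e 1 (r + 2 + 2) (by omega) ≫
        cross q t d e' 0 (r + 2 + 2) (by omega) ≫ cross q t d e'.flip 2 (r + 2 + 2) (by omega) ≫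
        cross q t d e.flip 1 (r + 2 + 2) (by omega) ≫ cap q t d (r + 2) =
      cap q t d r ≫ cup q t d r := by
  cases e'
  · exact cup_cross_pos_neg_cross_cap r hd e
  · exact cup_cross_neg_pos_cross_cap r hd e

theorem cup_cup_cross_two (e : CrossSign) (h : 2 + 2 ≤ r + 2 + 2) :
    cup q t d r ≫ cup q t d (r + 2) ≫ cross q t d e 2 (r + 2 + 2) h =
      ((e.unitPow q : kˣ) : k) • (cup q t d r ≫ cup q t d (r + 2)) := by
  rw [cup_comm _ 0 _ _ (by omega) _ rfl, reassoc_of% cup_cross_zero, Linear.smul_comp]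

theorem cross_two_cap_cap (e : CrossSign) (h : 2 + 2 ≤ r + 2 + 2) :
    cross q t d e 2 (r + 2 + 2) h ≫ cap q t d (r + 2) ≫ cap q t d r =
      ((e.unitPow q : kˣ) : k) • (cap q t d (r + 2) ≫ cap q t d r) := by
  rw [reassoc_of% cap_comm _ 0 _ _ (by omega) _ rfl, cross_zero_cap, Linear.comp_smul]

/-- The defining relation says that `X_0^+` and `X_2^+` agree after the two cups followed by
`X_1^+`. Both act by `q` directly on the two cups, so by the skein relation they also agree after
`X_1^-`. -/
theorem cup_cup_hump (e : CrossSign) :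
    cup q t d r ≫ cup q t d (r + 2) ≫ cross q t d e 1 (r + 2 + 2) (by omega) ≫
        cross q t d e 2 (r + 2 + 2) (by omega) ≫ cross q t d e.flip 0 (r + 2 + 2) (by omega) ≫
        cross q t d e.flip 1 (r + 2 + 2) (by omega) =
      cup q t d r ≫ cup q t d (r + 2) := by
  have h₀ : cup q t d r ≫ cup q t d (r + 2) ≫ cross q t d .pos 1 (r + 2 + 2) (by omega) ≫
        cross q t d .pos 2 (r + 2 + 2) (by omega) ≫ cross q t d .neg 0 (r + 2 + 2) (by omega) ≫
        cross q t d .neg 1 (r + 2 + 2) (by omega) =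
      cup q t d r ≫ cup q t d (r + 2) := Quot.sound (.hump_cup r)
  cases e
  · exact h₀
  · have h₁ : cup q t d r ≫ cup q t d (r + 2) ≫ cross q t d .pos 1 (r + 2 + 2) (by omega) ≫
          cross q t d .pos 0 (r + 2 + 2) (by omega) =
        cup q t d r ≫ cup q t d (r + 2) ≫ cross q t d .pos 1 (r + 2 + 2) (by omega) ≫
          cross q t d .pos 2 (r + 2 + 2) (by omega) := by
      have := h₀ =≫ (cross q t d .pos 1 (r + 2 + 2) (by omega) ≫
        cross q t d .pos 0 (r + 2 + 2) (by omega))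
      simp only [Category.assoc] at this
      rw [reassoc_of% neg_comp_pos, neg_comp_pos, Category.comp_id] at this
      exact this.symm
    have h₂ : cup q t d r ≫ cup q t d (r + 2) ≫ cross q t d .neg 1 (r + 2 + 2) (by omega) ≫
          cross q t d .pos 0 (r + 2 + 2) (by omega) =
        cup q t d r ≫ cup q t d (r + 2) ≫ cross q t d .neg 1 (r + 2 + 2) (by omega) ≫
          cross q t d .pos 2 (r + 2 + 2) (by omega) := by
      simp only [cross_neg 1, Preadditive.sub_comp, Preadditive.comp_sub, Linear.smul_comp,
        Linear.comp_smul, Category.id_comp, h₁, cup_cup_cross_two, cup_cross_zero]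
    have h₃ := h₂ =≫ (cross q t d .neg 2 (r + 2 + 2) (by omega) ≫
      cross q t d .pos 1 (r + 2 + 2) (by omega))
    simp only [Category.assoc] at h₃
    rw [reassoc_of% pos_comp_neg, neg_comp_pos, Category.comp_id] at h₃
    simp only [CrossSign.flip_neg]
    rw [reassoc_of% cross_comm .pos .neg 0 2 _ _ _ (by omega), h₃]

/-- The upside-down version of the argument for `cup_cup_hump`; here the defining relation is the
case of the negative sign. -/
theorem hump_cap_cap (e : CrossSign) :
    cross q t d e 1 (r + 2 + 2) (by omega) ≫ cross q t d e 0 (r + 2 + 2) (by omega) ≫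
        cross q t d e.flip 2 (r + 2 + 2) (by omega) ≫
        cross q t d e.flip 1 (r + 2 + 2) (by omega) ≫ cap q t d (r + 2) ≫ cap q t d r =
      cap q t d (r + 2) ≫ cap q t d r := by
  have h₀ : cross q t d .neg 1 (r + 2 + 2) (by omega) ≫
        cross q t d .neg 0 (r + 2 + 2) (by omega) ≫ cross q t d .pos 2 (r + 2 + 2) (by omega) ≫
        cross q t d .pos 1 (r + 2 + 2) (by omega) ≫ cap q t d (r + 2) ≫ cap q t d r =
      cap q t d (r + 2) ≫ cap q t d r := Quot.sound (.hump_cap r)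
  cases e
  · have h₁ : cross q t d .pos 2 (r + 2 + 2) (by omega) ≫
          cross q t d .pos 1 (r + 2 + 2) (by omega) ≫ cap q t d (r + 2) ≫ cap q t d r =
        cross q t d .pos 0 (r + 2 + 2) (by omega) ≫
          cross q t d .pos 1 (r + 2 + 2) (by omega) ≫ cap q t d (r + 2) ≫ cap q t d r := by
      have := (cross q t d .pos 0 (r + 2 + 2) (by omega) ≫
        cross q t d .pos 1 (r + 2 + 2) (by omega)) ≫= h₀
      simp only [Category.assoc] at this
      rwa [reassoc_of% pos_comp_neg, reassoc_of% pos_comp_neg] at this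
    have h₂ : cross q t d .pos 2 (r + 2 + 2) (by omega) ≫
          cross q t d .neg 1 (r + 2 + 2) (by omega) ≫ cap q t d (r + 2) ≫ cap q t d r =
        cross q t d .pos 0 (r + 2 + 2) (by omega) ≫
          cross q t d .neg 1 (r + 2 + 2) (by omega) ≫ cap q t d (r + 2) ≫ cap q t d r := by
      simp only [cross_neg 1, Preadditive.sub_comp, Preadditive.comp_sub, Linear.smul_comp,
        Linear.comp_smul, Category.id_comp, h₁, cross_two_cap_cap, reassoc_of% cross_zero_cap]
    simp only [CrossSign.flip_pos]
    rw [← reassoc_of% cross_comm .pos .neg 0 2 _ _ _ (by omega), ← h₂,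
      reassoc_of% neg_comp_pos, reassoc_of% pos_comp_neg]
  · exact h₀

end CupCap

/-! ### Cups and caps on the right -/

section RightMost

variable (e : CrossSign)

/-- A cup is created on the left of `n` strands; its right end moves to the right across `s`
strands; then its left end follows, with crossings of the opposite sign. -/
def cupMove (q t : kˣ) (d : k) (e : CrossSign) (s n : ℕ) (h : s ≤ n) :
    (B n : IQBrauer q t d) ⟶ B (n + 2) :=
  cup q t d n ≫ moveRight q t d e 1 (n + 2) s (by omega) ≫
    moveRight q t d e.flip 0 (n + 2) s (by omega)

/-- The strand at position `s` moves to the far left; then the next strand follows, with crossings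
of the opposite sign; then these two strands are closed by a cap. -/
def capMove (q t : kˣ) (d : k) (e : CrossSign) (s n : ℕ) (h : s ≤ n) :
    (B (n + 2) : IQBrauer q t d) ⟶ B n :=
  moveLeft q t d e 0 (n + 2) s (by omega) ≫
    moveLeft q t d e.flip 1 (n + 2) s (by omega) ≫ cap q t d n

/-- Sliding through each of the two moved strands shifts the crossing by one place, and passing the
cup undoes the shift by two. -/
theorem cupMove_cross (e' : CrossSign) (i n : ℕ) (h : i + 2 ≤ n) :
    cupMove q t d e n n le_rfl ≫ cross q t d e' i (n + 2) (by omega) =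
      cross q t d e' i n h ≫ cupMove q t d e n n le_rfl := by
  simp only [cupMove, Category.assoc]
  rw [moveRight_cross _ _ _ (i + 1) _ _ _ _ _ rfl (by omega) (by omega),
    reassoc_of% moveRight_cross _ _ _ (i + 1 + 1) _ _ _ _ _ rfl (by omega) (by omega),
    reassoc_of% cup_comm _ i _ _ h _ rfl]

theorem cross_capMove (e' : CrossSign) (i n : ℕ) (h : i + 2 ≤ n) :
    cross q t d e' i (n + 2) (by omega) ≫ capMove q t d e n n le_rfl =
      capMove q t d e n n le_rfl ≫ cross q t d e' i n h := by
  simp only [capMove, Category.assoc]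
  rw [reassoc_of% cross_moveLeft _ _ _ (i + 1) _ _ _ _ _ rfl (by omega) (by omega),
    reassoc_of% cross_moveLeft _ _ _ (i + 1 + 1) _ _ _ _ _ rfl (by omega) (by omega),
    cap_comm _ i _ _ h _ rfl]

/-- The first crossings of the two strands of `cupMove`, split off. -/
theorem cupMove_add_two (r : ℕ) :
    cupMove q t d e (r + 2) (r + 2) le_rfl =
      cup q t d (r + 2) ≫ cross q t d e 1 (r + 2 + 2) (by omega) ≫
      cross q t d e 2 (r + 2 + 2) (by omega) ≫ cross q t d e.flip 0 (r + 2 + 2) (by omega) ≫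
      cross q t d e.flip 1 (r + 2 + 2) (by omega) ≫
      moveRight q t d e 3 (r + 2 + 2) r (by omega) ≫
      moveRight q t d e.flip 2 (r + 2 + 2) r (by omega) := by
  rw [cupMove, moveRight_succ_left e 1 2 _ _ _ rfl, moveRight_succ_left e 2 3 _ _ _ rfl,
    moveRight_succ_left e.flip 0 1 _ _ _ rfl, moveRight_succ_left e.flip 1 2 _ _ _ rfl]
  simp only [Category.assoc]
  rw [reassoc_of% moveRight_comm_left _ _ 3 0 _ _ _ _ (by omega),
    reassoc_of% moveRight_comm_left _ _ 3 1 _ _ _ _ (by omega)]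

theorem capMove_add_two (r : ℕ) :
    capMove q t d e (r + 2) (r + 2) le_rfl = moveLeft q t d e 2 (r + 2 + 2) r (by omega) ≫
      moveLeft q t d e.flip 3 (r + 2 + 2) r (by omega) ≫
      cross q t d e 1 (r + 2 + 2) (by omega) ≫ cross q t d e 0 (r + 2 + 2) (by omega) ≫
      cross q t d e.flip 2 (r + 2 + 2) (by omega) ≫
      cross q t d e.flip 1 (r + 2 + 2) (by omega) ≫ cap q t d (r + 2) := by
  rw [capMove, moveLeft_succ_right e 0 1 _ _ _ rfl, moveLeft_succ_right e 1 2 _ _ _ rfl,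
    moveLeft_succ_right e.flip 1 2 _ _ _ rfl, moveLeft_succ_right e.flip 2 3 _ _ _ rfl]
  simp only [Category.assoc]
  rw [← reassoc_of% moveLeft_comm_left _ _ 3 0 _ _ _ _ (by omega),
    ← reassoc_of% moveLeft_comm_left _ _ 3 1 _ _ _ _ (by omega)]

/-- The hump cancels against the two cups, and the remaining crossings pass the cup on `r + 2`
strands, turning into the crossings of the shorter `cupMove`. -/
theorem cupMove_cup (r : ℕ) :
    cupMove q t d e r r le_rfl ≫ cup q t d (r + 2) =
      cup q t d r ≫ cupMove q t d e (r + 2) (r + 2) le_rfl := by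
  rw [cupMove_add_two, reassoc_of% cup_cup_hump,
    reassoc_of% cup_moveRight _ 1 _ _ _ (by omega) _ rfl,
    cup_moveRight _ 0 _ _ _ (by omega) _ rfl, cupMove, Category.assoc, Category.assoc]

theorem cap_capMove (r : ℕ) :
    cap q t d (r + 2) ≫ capMove q t d e r r le_rfl =
      capMove q t d e (r + 2) (r + 2) le_rfl ≫ cap q t d r := by
  rw [capMove_add_two]
  simp only [Category.assoc]
  rw [hump_cap_cap, reassoc_of% moveLeft_cap _ 1 _ _ _ (by omega) _ rfl,
    reassoc_of% moveLeft_cap _ 0 _ _ _ (by omega) _ rfl, capMove]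

/-- Once the distant crossings have passed the cap, the hump is enclosed between a cup and a cap,
and `cup_hump_cap` turns it into a cap followed by a cup. -/
theorem cupMove_cap (hd : d * ((q : k) - (q⁻¹ : kˣ)) = (t : k) - (t⁻¹ : kˣ)) (r : ℕ) :
    cupMove q t d e (r + 2) (r + 2) le_rfl ≫ cap q t d (r + 2) =
      cap q t d r ≫ cupMove q t d e r r le_rfl := by
  have h := cup_hump_cap r hd e e.flip
  simp only [CrossSign.flip_flip] at h
  simp only [cupMove_add_two, Category.assoc]
  rw [moveRight_cap _ 0 _ _ _ (by omega) _ rfl,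
    reassoc_of% moveRight_cap _ 1 _ _ _ (by omega) _ rfl,
    reassoc_of% cross_comm _ _ 0 2 _ _ _ (by omega), cupMove]
  simpa only [Category.assoc] using h =≫ (moveRight q t d e 1 (r + 2) r (by omega) ≫
    moveRight q t d e.flip 0 (r + 2) r (by omega))

theorem cup_capMove (hd : d * ((q : k) - (q⁻¹ : kˣ)) = (t : k) - (t⁻¹ : kˣ)) (r : ℕ) :
    cup q t d (r + 2) ≫ capMove q t d e (r + 2) (r + 2) le_rfl =
      capMove q t d e r r le_rfl ≫ cup q t d r := by
  rw [capMove_add_two, reassoc_of% cup_moveLeft _ 0 _ _ _ (by omega) _ rfl,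
    reassoc_of% cup_moveLeft _ 1 _ _ _ (by omega) _ rfl, cup_hump_cap r hd e e, capMove]
  simp only [Category.assoc]

end RightMost

/-! ### The functor that adds a strand -/

section AddStrand

instance : (addStrand q t d).Additive where
  map_add := by rintro X Y ⟨f⟩ ⟨g⟩; rfl

instance : (addStrand q t d).Linear k where
  map_smul := by rintro X Y ⟨f⟩ a; rfl

theorem addStrand_map_moveRight (e : CrossSign) (i n s : ℕ) (h : i + s + 1 ≤ n) :
    (addStrand q t d).map (moveRight q t d e i n s h) =
      moveRight q t d e i (n + 1) s (by omega) := by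
  induction s with
  | zero => exact CategoryTheory.Functor.map_id _ _
  | succ s ih => rw [moveRight, Functor.map_comp, ih]; rfl

theorem addStrand_map_moveLeft (e : CrossSign) (i n s : ℕ) (h : i + s + 1 ≤ n) :
    (addStrand q t d).map (moveLeft q t d e i n s h) =
      moveLeft q t d e i (n + 1) s (by omega) := by
  induction s with
  | zero => exact CategoryTheory.Functor.map_id _ _
  | succ s ih => rw [moveLeft, Functor.map_comp, ih]; rfl

theorem addStrand_map_cupMove (e : CrossSign) (s n : ℕ) (h : s ≤ n) :
    (addStrand q t d).map (cupMove q t d e s n h) =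
      cupMove q t d e s (n + 1) (by omega) := by
  rw [cupMove, Functor.map_comp, Functor.map_comp, addStrand_map_moveRight,
    addStrand_map_moveRight]
  rfl

theorem addStrand_map_capMove (e : CrossSign) (s n : ℕ) (h : s ≤ n) :
    (addStrand q t d).map (capMove q t d e s n h) =
      capMove q t d e s (n + 1) (by omega) := by
  rw [capMove, Functor.map_comp, Functor.map_comp, addStrand_map_moveLeft,
    addStrand_map_moveLeft]
  rfl

/-- Two linear functors on the iquantum Brauer category and a family of morphisms that is natural
with respect to the generating morphisms give a natural transformation. -/
def natTransOfGen {C : Type*} [Category C] [Preadditive C] [Linear k C]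
    {F G : IQBrauer q t d ⥤ C} [F.Additive] [G.Additive] [F.Linear k] [G.Linear k]
    (α : ∀ r, F.obj (B r) ⟶ G.obj (B r))
    (h_cup : ∀ r, F.map (cup q t d r) ≫ α (r + 2) = α r ≫ G.map (cup q t d r))
    (h_cap : ∀ r, F.map (cap q t d r) ≫ α r = α (r + 2) ≫ G.map (cap q t d r))
    (h_cross : ∀ e i n h, F.map (cross q t d e i n h) ≫ α n =
      α n ≫ G.map (cross q t d e i n h)) : F ⟶ G where
  app X := α X.strands
  naturality := by
    -- Morphisms are classes of expressions, so induction on a representative suffices; the defining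
    -- relations need not be consulted.
    suffices key : ∀ {m n : ℕ} (f : IQBTerm k m n),
        F.map (X := B m) (Y := B n) (mk q t d f) ≫ α n =
          α m ≫ G.map (X := B m) (Y := B n) (mk q t d f) by
      rintro ⟨m⟩ ⟨n⟩ ⟨f⟩
      exact key f
    intro m n f
    induction f with
    | gen g =>
      cases g with
      | cup => exact h_cup _
      | cap => exact h_cap _
      | cross e i _ h => exact h_cross e i _ h
    | one n =>
      rw [show mk q t d (.one n) = 𝟙 (B n : IQBrauer q t d) from rfl]
      simp
    | @comp l m n f g hf hg =>
      let f' : (B l : IQBrauer q t d) ⟶ B m := mk q t d f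
      let g' : (B m : IQBrauer q t d) ⟶ B n := mk q t d g
      change F.map f' ≫ α m = α l ≫ G.map f' at hf
      change F.map g' ≫ α n = α m ≫ G.map g' at hg
      change F.map (f' ≫ g') ≫ α n = α l ≫ G.map (f' ≫ g')
      rw [F.map_comp, G.map_comp, Category.assoc, hg, reassoc_of% hf]
    | zero m n =>
      change F.map (0 : (B m : IQBrauer q t d) ⟶ B n) ≫ α n =
        α m ≫ G.map (0 : (B m : IQBrauer q t d) ⟶ B n)
      simp
    | @add m n f g hf hg =>
      let f' : (B m : IQBrauer q t d) ⟶ B n := mk q t d f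
      let g' : (B m : IQBrauer q t d) ⟶ B n := mk q t d g
      change F.map f' ≫ α n = α m ≫ G.map f' at hf
      change F.map g' ≫ α n = α m ≫ G.map g' at hg
      change F.map (f' + g') ≫ α n = α m ≫ G.map (f' + g')
      rw [F.map_add, G.map_add, Preadditive.add_comp, Preadditive.comp_add, hf, hg]
    | @smul m n a f hf =>
      let f' : (B m : IQBrauer q t d) ⟶ B n := mk q t d f
      change F.map f' ≫ α n = α m ≫ G.map f' at hf
      change F.map (a • f') ≫ α n = α m ≫ G.map (a • f')
      rw [F.map_smul, G.map_smul, Linear.smul_comp, Linear.comp_smul, hf]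

end AddStrand

/-! ### Long-range curls and zigzags -/

section Curl

variable (e : CrossSign)

theorem moveRight_comp_moveLeft (e' : CrossSign) (i n s : ℕ) (h : i + s + 1 ≤ n)
    (he : e' = e.flip) :
    moveRight q t d e i n s h ≫ moveLeft q t d e' i n s h = 𝟙 _ := by
  subst he
  exact moveRight_moveLeft_flip e i n s h

theorem moveLeft_comp_moveRight (e' : CrossSign) (i n s : ℕ) (h : i + s + 1 ≤ n)
    (he : e' = e.flip) :
    moveLeft q t d e i n s h ≫ moveRight q t d e' i n s h = 𝟙 _ := by
  subst he
  simpa using moveLeft_flip_moveRight (q := q) (t := t) (d := d) e.flip i n s h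

/-- Sliding the shorter move through the longer one leaves a single crossing at position `1`,
between inverse moves starting at position `2`. The outer moves pass the cup and the cap, a curl is
extracted, and then they cancel. -/
theorem cup_moveRight_moveLeft_cap (hd : d * ((q : k) - (q⁻¹ : kˣ)) = (t : k) - (t⁻¹ : kˣ))
    (n s : ℕ) (h : s + 1 ≤ n) :
    cup q t d n ≫ moveRight q t d e 1 (n + 2) (s + 1) (by omega) ≫
        moveLeft q t d e.flip 1 (n + 2) s (by omega) ≫ cap q t d n =
      ((e.unitPow t : kˣ) : k) • 𝟙 _ := by
  rw [reassoc_of% moveRight_moveLeft _ _ 1 2 _ _ _ _ (by omega) rfl,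
    moveRight_succ_left _ 1 2 _ _ _ rfl,
    Category.assoc, moveRight_cap _ 0 _ _ _ (by omega) _ rfl,
    reassoc_of% cup_moveLeft _ 0 _ _ _ (by omega) _ rfl, cup_cross_cap_assoc _ hd, Linear.comp_smul,
    moveLeft_comp_moveRight _ _ _ _ _ _ (by simp)]

theorem cup_moveRight_moveLeft_cap' (hd : d * ((q : k) - (q⁻¹ : kˣ)) = (t : k) - (t⁻¹ : kˣ))
    (n s : ℕ) (h : s + 1 ≤ n) :
    cup q t d n ≫ moveRight q t d e.flip 1 (n + 2) s (by omega) ≫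
        moveLeft q t d e 1 (n + 2) (s + 1) (by omega) ≫ cap q t d n =
      ((e.unitPow t : kˣ) : k) • 𝟙 _ := by
  rw [reassoc_of% moveRight_moveLeft' _ _ 1 2 _ _ _ _ (by omega) rfl,
    moveLeft_succ_right _ 1 2 _ _ _ rfl,
    Category.assoc, moveRight_cap _ 0 _ _ _ (by omega) _ rfl,
    reassoc_of% cup_moveLeft _ 0 _ _ _ (by omega) _ rfl, cup_cross_cap_assoc _ hd, Linear.comp_smul,
    moveLeft_comp_moveRight _ _ _ _ _ _ (by simp)]

/-- The second strand of the cup and the first strand of the cap leave one crossing at position `0`,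
absorbed by the cap with a power of `q`; the other two moves form the curl of
`cup_moveRight_moveLeft_cap`. For `e = .pos` the result is `q⁻¹ t`, the inverse of the scalar in the
right cap. -/
theorem cupMove_zigzag (hd : d * ((q : k) - (q⁻¹ : kˣ)) = (t : k) - (t⁻¹ : kˣ))
    (n s : ℕ) (h : s + 1 ≤ n) :
    cupMove q t d e (s + 1) n h ≫ capMove q t d e.flip s n (by omega) =
      (((e.unitPow q)⁻¹ * e.unitPow t : kˣ) : k) • 𝟙 _ := by
  simp only [cupMove, capMove, Category.assoc, CrossSign.flip_flip]
  rw [reassoc_of% moveRight_moveLeft _ _ 0 1 _ _ _ _ (by omega) rfl,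
    moveRight_succ_left _ 0 1 _ _ _ rfl, Category.assoc,
    reassoc_of% moveRight_comp_moveLeft _ _ _ _ _ _ (by simp), cross_zero_cap, Linear.comp_smul,
    Linear.comp_smul, Linear.comp_smul, cup_moveRight_moveLeft_cap e hd n s h, smul_smul,
    CrossSign.unitPow_flip, Units.val_mul]

theorem cupMove_zigzag' (hd : d * ((q : k) - (q⁻¹ : kˣ)) = (t : k) - (t⁻¹ : kˣ))
    (n s : ℕ) (h : s + 1 ≤ n) :
    cupMove q t d e s n (by omega) ≫ capMove q t d e.flip (s + 1) n h =
      (((e.unitPow q)⁻¹ * e.unitPow t : kˣ) : k) • 𝟙 _ := by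
  simp only [cupMove, capMove, Category.assoc, CrossSign.flip_flip]
  rw [reassoc_of% moveRight_moveLeft' _ _ 0 1 _ _ _ _ (by omega) rfl,
    moveLeft_succ_right _ 0 1 _ _ _ rfl, Category.assoc,
    reassoc_of% moveRight_comp_moveLeft _ _ _ _ _ _ rfl, reassoc_of% cup_cross_zero,
      Linear.smul_comp,
    cup_moveRight_moveLeft_cap' e hd n s h, smul_smul,
    CrossSign.unitPow_flip, Units.val_mul]

theorem cupMove_capMove (s n : ℕ) (h : s ≤ n) :
    cupMove q t d e s n h ≫ capMove q t d e s n h = d • 𝟙 _ := by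
  simp only [cupMove, capMove, Category.assoc]
  rw [reassoc_of% moveRight_comp_moveLeft _ _ _ _ _ _ (by simp),
    reassoc_of% moveRight_comp_moveLeft _ _ _ _ _ _ (by simp), cup_cap]

/-- The crossing prolongs the move of the right end of the cup by one step. It commutes with the
move of the left end, which then cancels against the cap. -/
theorem cupMove_curl_left (hd : d * ((q : k) - (q⁻¹ : kˣ)) = (t : k) - (t⁻¹ : kˣ))
    (n s : ℕ) (h : s + 1 ≤ n) :
    cupMove q t d e s n (by omega) ≫ cross q t d e (s + 1) (n + 2) (by omega) ≫
        capMove q t d e s n (by omega) = ((e.unitPow t : kˣ) : k) • 𝟙 _ := by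
  have := cup_moveRight_moveLeft_cap e hd n s h
  rw [moveRight] at this
  simp only [Nat.add_comm 1 s, Category.assoc] at this
  simp only [cupMove, capMove, Category.assoc]
  rw [reassoc_of% moveRight_comm_right _ _ _ _ _ _ _ _ (by omega),
    reassoc_of% moveRight_comp_moveLeft _ _ _ _ _ _ (by simp), this]

theorem cupMove_curl_right (hd : d * ((q : k) - (q⁻¹ : kˣ)) = (t : k) - (t⁻¹ : kˣ))
    (n s : ℕ) (h : s + 1 ≤ n) :
    cupMove q t d e (s + 1) n h ≫ cross q t d e.flip s (n + 2) (by omega) ≫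
        capMove q t d e (s + 1) n h = (((e.unitPow t)⁻¹ : kˣ) : k) • 𝟙 _ := by
  simp only [cupMove, capMove, Category.assoc]
  -- The first crossing of this left move is the inverse of the inserted one, so the move becomes
  -- one step shorter. The two strands then no longer cancel outright but leave a curl.
  rw [moveLeft.eq_2 _ _ _ e 0 _ s]
  simp only [Nat.zero_add, Category.assoc, flip_cross_assoc]
  rw [reassoc_of% moveRight_moveLeft _ _ 0 1 _ _ _ _ (by omega) rfl,
    reassoc_of% moveRight_moveLeft _ _ 1 2 _ _ _ _ (by omega) rfl,
    moveRight_succ_left e.flip 0 1 _ _ _ rfl, Category.assoc,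
    reassoc_of% moveRight_moveLeft' _ _ 1 2 _ _ _ _ (by omega) rfl,
    moveRight_succ_left e 1 2 _ _ _ rfl, moveLeft_succ_right e.flip 1 2 _ _ _ rfl]
  simp only [Category.assoc]
  rw [reassoc_of% moveRight_comm_left _ _ 2 0 _ _ _ _ (by omega),
    reassoc_of% moveRight_comp_moveLeft _ _ _ _ _ _ rfl,
    moveRight_cap _ 0 _ _ _ (by omega) _ rfl, reassoc_of% cup_moveLeft _ 0 _ _ _ (by omega) _ rfl,
    -- Three crossings remain at positions `1`, `0`, `1`. Rewritten at `0`, `1`, `0`, the outer two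
    -- are absorbed with inverse powers of `q`, leaving a curl of sign `e.flip`.
    reassoc_of% cross_conj _ _ 0 1 _ _ rfl, reassoc_of% cup_cross_zero, reassoc_of% cross_zero_cap]
  simp only [Linear.smul_comp, Linear.comp_smul]
  rw [cup_cross_cap_assoc _ hd, Linear.comp_smul, moveLeft_comp_moveRight _ _ _ _ _ _ rfl]
  simp [smul_smul]

/-- The middle crossing cancels the first crossing of the first strand of the cap. The first
crossing of its second strand commutes with the moves below it and passes the cup, which leaves the
zigzag of `cupMove_zigzag'`. -/
theorem cupMove_cross_capMove (hd : d * ((q : k) - (q⁻¹ : kˣ)) = (t : k) - (t⁻¹ : kˣ))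
    (n s : ℕ) (h : s + 2 ≤ n) :
    cupMove q t d e s n (by omega) ≫ cross q t d e (s + 1) (n + 2) (by omega) ≫
        capMove q t d e.flip (s + 2) n h =
      (((e.unitPow q)⁻¹ * e.unitPow t : kˣ) : k) • cross q t d e s n h := by
  have := cupMove_zigzag' e hd n s (by omega)
  simp only [cupMove, capMove, Category.assoc, CrossSign.flip_flip] at this ⊢
  rw [moveLeft.eq_2 _ _ _ e.flip _ _ (s + 1), moveLeft.eq_2 _ _ _ e 1 _ (s + 1)]
  simp only [Category.assoc, Nat.zero_add, Nat.add_comm 1 (s + 1), cross_flip_assoc]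
  rw [reassoc_of% moveLeft_comm_right _ _ _ _ _ _ _ _ (by omega),
    reassoc_of% moveRight_comm_right _ _ _ _ _ _ _ _ (by omega),
    reassoc_of% moveRight_comm_right _ _ _ _ _ _ _ _ (by omega),
    reassoc_of% cup_comm _ s _ _ h _ rfl, this, Linear.comp_smul, Category.comp_id]

theorem cupMove_cross_capMove' (hd : d * ((q : k) - (q⁻¹ : kˣ)) = (t : k) - (t⁻¹ : kˣ))
    (n s : ℕ) (h : s + 2 ≤ n) :
    cupMove q t d e (s + 2) n h ≫ cross q t d e (s + 1) (n + 2) (by omega) ≫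
        capMove q t d e.flip s n (by omega) =
      (((e.unitPow q)⁻¹ * e.unitPow t : kˣ) : k) • cross q t d e s n h := by
  have := cupMove_zigzag e hd n s (by omega) =≫ cross q t d e s n h
  simp only [cupMove, capMove, Category.assoc, CrossSign.flip_flip] at this ⊢
  rw [moveRight.eq_2 _ _ _ e.flip _ _ (s + 1), moveRight.eq_2 _ _ _ e 1 _ (s + 1)]
  simp only [Category.assoc, Nat.zero_add, Nat.add_comm 1 (s + 1), flip_cross_assoc]
  rw [← reassoc_of% moveRight_comm_right _ _ _ _ _ _ _ _ (by omega),
    ← reassoc_of% moveLeft_comm_right _ _ _ _ _ _ _ _ (by omega),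
    ← reassoc_of% moveLeft_comm_right _ _ _ _ _ _ _ _ (by omega),
    cap_comm _ s _ _ h _ rfl, this, Linear.smul_comp, Category.id_comp]

end Curl

/-! ### The natural transformations -/

section NatTrans

/-- Adding the crossing of sign `e` on the right. -/
def crossNatTrans (q t : kˣ) (d : k) (e : CrossSign) :
    addStrand q t d ⋙ addStrand q t d ⟶ addStrand q t d ⋙ addStrand q t d :=
  natTransOfGen (fun r => cross q t d e r (r + 2) le_rfl)
    (fun r => cup_comm e r (r + 2) (r + 2) le_rfl le_rfl rfl)
    (fun r => (cap_comm e r (r + 2) (r + 2) le_rfl le_rfl rfl).symm)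
    (fun e' i n h => (cross_comm e' e i n (n + 2) (by omega) le_rfl h).symm)

/-- The natural transformation with components `cupMove`. -/
def cupNatTrans (e : CrossSign)
    (hd : d * ((q : k) - (q⁻¹ : kˣ)) = (t : k) - (t⁻¹ : kˣ)) :
    𝟭 (IQBrauer q t d) ⟶ addStrand q t d ⋙ addStrand q t d :=
  natTransOfGen (fun r => cupMove q t d e r r le_rfl)
    (fun r => (cupMove_cup e r).symm)
    (fun r => (cupMove_cap e hd r).symm)
    (fun e' i n h => (cupMove_cross e e' i n h).symm)

/-- The natural transformation with components `capMove`. -/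
def capNatTrans (e : CrossSign)
    (hd : d * ((q : k) - (q⁻¹ : kˣ)) = (t : k) - (t⁻¹ : kˣ)) :
    addStrand q t d ⋙ addStrand q t d ⟶ 𝟭 (IQBrauer q t d) :=
  natTransOfGen (fun r => capMove q t d e r r le_rfl)
    (fun r => cup_capMove e hd r)
    (fun r => cap_capMove e r)
    (fun e' i n h => cross_capMove e e' i n h)

end NatTrans

/-! ### The action of the oriented skein category -/

section Action

/-- The functor that adds as many strands as there are letters in the given word. -/
def addWord (q t : kˣ) (d : k) : List Strand → (IQBrauer q t d ⥤ IQBrauer q t d)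
  | [] => 𝟭 _
  | _ :: X => addStrand q t d ⋙ addWord q t d X

instance addWord_additive (X : List Strand) : (addWord q t d X).Additive := by
  induction X with
  | nil => exact inferInstanceAs (𝟭 _).Additive
  | cons s X ih => exact inferInstanceAs (addStrand q t d ⋙ addWord q t d X).Additive

instance addWord_linear (X : List Strand) : (addWord q t d X).Linear k := by
  induction X with
  | nil => exact inferInstanceAs ((𝟭 _).Linear k)
  | cons s X ih => exact inferInstanceAs ((addStrand q t d ⋙ addWord q t d X).Linear k)

theorem addWord_append (X Y : List Strand) :
    addWord q t d (X ++ Y) = addWord q t d X ⋙ addWord q t d Y := by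
  induction X with
  | nil => rfl
  | cons s X ih => exact congrArg (addStrand q t d ⋙ ·) ih

/-- The natural transformation given by a generating morphism. -/
def evalGen (hd : d * ((q : k) - (q⁻¹ : kˣ)) = (t : k) - (t⁻¹ : kˣ)) :
    ∀ {X Y : List Strand}, OSGen X Y → (addWord q t d X ⟶ addWord q t d Y)
  | _, _, .posCross => crossNatTrans q t d .pos
  | _, _, .negCross => crossNatTrans q t d .neg
  | _, _, .rightCup => cupNatTrans .pos hd
  | _, _, .rightCap => ((q * t⁻¹ : kˣ) : k) • capNatTrans .neg hd
  | _, _, .leftCup => ((q⁻¹ * t : kˣ) : k) • cupNatTrans .neg hd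
  | _, _, .leftCap => capNatTrans .pos hd

/-- The natural transformation given by an expression. -/
def eval (hd : d * ((q : k) - (q⁻¹ : kˣ)) = (t : k) - (t⁻¹ : kˣ)) :
    ∀ {X Y : List Strand}, OSTerm k X Y → (addWord q t d X ⟶ addWord q t d Y)
  | _, _, .gen g => evalGen hd g
  | _, _, .one _ => 𝟙 _
  | _, _, .comp f g => eval hd f ≫ eval hd g
  | _, _, .tensor f g => eqToHom (addWord_append _ _) ≫ (eval hd f ◫ eval hd g) ≫
      eqToHom (addWord_append _ _).symm
  | _, _, .zero _ _ => 0
  | _, _, .add f g => eval hd f + eval hd g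
  | _, _, .smul a f => a • eval hd f

variable (hd : d * ((q : k) - (q⁻¹ : kˣ)) = (t : k) - (t⁻¹ : kˣ))

theorem eval_cast {X Y X' Y' : List Strand} (hX : X = X') (hY : Y = Y') (f : OSTerm k X Y) :
    eval hd (f.cast hX hY) = eqToHom (by rw [hX]) ≫ eval hd f ≫ eqToHom (by rw [hY]) := by
  subst hX hY
  simp [OSTerm.cast]

theorem eqToHom_comp_heq' {C : Type*} [Category C] {W X Y Z : C} (f : X ⟶ Y) (h : W = X)
    (h' : Y = Z) : HEq (eqToHom h ≫ f ≫ eqToHom h') f := by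
  subst h h'
  simp

/-- The equality is heterogeneous because, for variable words, the functor of a concatenation is
only propositionally the composite. For explicit words the objects agree by definition, and
`eq_of_heq` yields an ordinary equation. -/
theorem eval_tensor_app_heq {X Y X' Y' : List Strand} (f : OSTerm k X Y) (g : OSTerm k X' Y')
    (Z : IQBrauer q t d) :
    HEq ((eval hd (f.tensor g)).app Z) ((eval hd g).app ((addWord q t d X).obj Z) ≫
      (addWord q t d Y').map ((eval hd f).app Z)) := by
  simp only [eval, NatTrans.comp_app, eqToHom_app]
  exact eqToHom_comp_heq' _ _ _

theorem eval_tensor_one_app_heq {X Y : List Strand} (W : List Strand) (f : OSTerm k X Y)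
    (Z : IQBrauer q t d) :
    HEq ((eval hd (f.tensor (.one W))).app Z) ((addWord q t d W).map ((eval hd f).app Z)) := by
  refine (eval_tensor_app_heq hd f (.one W) Z).trans (heq_of_eq ?_)
  simp [eval]

theorem eval_one_tensor_app_heq {X Y : List Strand} (W : List Strand) (f : OSTerm k X Y)
    (Z : IQBrauer q t d) :
    HEq ((eval hd ((OSTerm.one W).tensor f)).app Z)
      ((eval hd f).app ((addWord q t d W).obj Z)) := by
  refine (eval_tensor_app_heq hd (.one W) f Z).trans (heq_of_eq ?_)
  simp [eval]

/-! ### The relations of the oriented skein category, on components -/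

/-- The scalar of the right cap is exactly the inverse of the factor `q⁻¹ t` in
`cupMove_cross_capMove`. Together with `eval_negLeftCross` this makes the invertibility of `ρ` a
consequence of that of the crossings. -/
theorem eval_posRightCross :
    eval hd (OSTerm.posRightCross k) = crossNatTrans q t d .pos := by
  ext ⟨r⟩
  have h₁ : (eval hd ((OSTerm.gen .rightCup).tensor (.one [.up, .down]))).app (B r) =
      cupMove q t d .pos r (r + 2) (by omega) :=
    (eq_of_heq (eval_tensor_one_app_heq hd _ _ _)).trans
      ((congrArg (addStrand q t d).map (addStrand_map_cupMove .pos r r le_rfl)).trans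
        (addStrand_map_cupMove .pos r (r + 1) _))
  have h₂ : (eval hd ((OSTerm.one [.down]).tensor
      ((OSTerm.gen .posCross).tensor (.one [.down])))).app (B r) =
      cross q t d .pos (r + 1) (r + 4) (by omega) :=
    (eq_of_heq (eval_one_tensor_app_heq hd _ _ _)).trans
      (eq_of_heq (eval_tensor_one_app_heq hd _ _ _))
  have h₃ : (eval hd ((OSTerm.one [.down, .up]).tensor (OSTerm.gen .rightCap))).app (B r) =
      ((q * t⁻¹ : kˣ) : k) • capMove q t d .neg (r + 2) (r + 2) le_rfl :=
    eq_of_heq (eval_one_tensor_app_heq hd _ _ _)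
  refine (congrArg₂ (· ≫ ·) h₁ (congrArg₂ (· ≫ ·) h₂ h₃)).trans ?_
  have h := cupMove_cross_capMove .pos hd (r + 2) r le_rfl
  change cupMove q t d .pos r (r + 2) _ ≫ cross q t d .pos (r + 1) (r + 4) _ ≫
    (((q * t⁻¹ : kˣ) : k) • capMove q t d .neg (r + 2) (r + 2) le_rfl) =
    cross q t d .pos r (r + 2) le_rfl
  rw [Linear.comp_smul, Linear.comp_smul]
  refine (congrArg (_ • ·) h).trans ?_
  rw [smul_smul, ← Units.val_mul, CrossSign.unitPow_pos, CrossSign.unitPow_pos,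
    mul_mul_mul_comm, mul_inv_cancel, inv_mul_cancel, one_mul, Units.val_one, one_smul]

theorem eval_negLeftCross :
    eval hd (OSTerm.negLeftCross k) = crossNatTrans q t d .neg := by
  ext ⟨r⟩
  have h₁ : (eval hd ((OSTerm.one [.down, .up]).tensor (OSTerm.gen .leftCup))).app (B r) =
      ((q⁻¹ * t : kˣ) : k) • cupMove q t d .neg (r + 2) (r + 2) le_rfl :=
    eq_of_heq (eval_one_tensor_app_heq hd _ _ _)
  have h₂ : (eval hd ((OSTerm.one [.down]).tensor
      ((OSTerm.gen .negCross).tensor (.one [.down])))).app (B r) =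
      cross q t d .neg (r + 1) (r + 4) (by omega) :=
    (eq_of_heq (eval_one_tensor_app_heq hd _ _ _)).trans
      (eq_of_heq (eval_tensor_one_app_heq hd _ _ _))
  have h₃ : (eval hd ((OSTerm.gen .leftCap).tensor (.one [.up, .down]))).app (B r) =
      capMove q t d .pos r (r + 2) (by omega) :=
    (eq_of_heq (eval_tensor_one_app_heq hd _ _ _)).trans
      ((congrArg (addStrand q t d).map (addStrand_map_capMove .pos r r le_rfl)).trans
        (addStrand_map_capMove .pos r (r + 1) _))
  refine (congrArg₂ (· ≫ ·) h₁ (congrArg₂ (· ≫ ·) h₂ h₃)).trans ?_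
  have h := cupMove_cross_capMove' .neg hd (r + 2) r le_rfl
  change (((q⁻¹ * t : kˣ) : k) • cupMove q t d .neg (r + 2) (r + 2) _) ≫
    cross q t d .neg (r + 1) (r + 4) _ ≫ capMove q t d .pos r (r + 2) _ =
    cross q t d .neg r (r + 2) le_rfl
  rw [Linear.smul_comp]
  refine (congrArg (_ • ·) h).trans ?_
  rw [smul_smul, ← Units.val_mul, CrossSign.unitPow_neg, CrossSign.unitPow_neg, inv_inv,
    mul_mul_mul_comm, mul_inv_cancel, inv_mul_cancel, one_mul, Units.val_one, one_smul]

theorem crossNatTrans_pos_neg :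
    crossNatTrans q t d .pos ≫ crossNatTrans q t d .neg = 𝟙 _ := by
  ext ⟨r⟩
  exact cross_flip .pos r (r + 2) le_rfl

theorem crossNatTrans_neg_pos :
    crossNatTrans q t d .neg ≫ crossNatTrans q t d .pos = 𝟙 _ := by
  ext ⟨r⟩
  exact cross_flip .neg r (r + 2) le_rfl

theorem eval_braid :
    eval hd (((OSTerm.gen .posCross).tensor (.one [.up])).comp
      (((OSTerm.one [.up]).tensor (.gen .posCross)).comp
        ((OSTerm.gen .posCross).tensor (.one [.up])))) =
    eval hd (((OSTerm.one [.up]).tensor (.gen .posCross)).comp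
      (((OSTerm.gen .posCross).tensor (.one [.up])).comp
        ((OSTerm.one [.up]).tensor (.gen .posCross)))) := by
  ext ⟨r⟩
  have h₁ : (eval hd ((OSTerm.gen .posCross).tensor (.one [.up]))).app (B r) =
      cross q t d .pos r (r + 3) (by omega) :=
    eq_of_heq (eval_tensor_one_app_heq hd _ _ _)
  have h₂ : (eval hd ((OSTerm.one [.up]).tensor (.gen .posCross))).app (B r) =
      cross q t d .pos (r + 1) (r + 3) (by omega) :=
    eq_of_heq (eval_one_tensor_app_heq hd _ _ _)
  exact ((congrArg₂ (· ≫ ·) h₁ (congrArg₂ (· ≫ ·) h₂ h₁)).trans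
    (cross_braid_pos r (r + 3) le_rfl)).trans
      (congrArg₂ (· ≫ ·) h₂ (congrArg₂ (· ≫ ·) h₁ h₂)).symm

theorem eval_skein :
    eval hd (OSTerm.add (.gen .posCross) ((OSTerm.gen .negCross).smul (-1))) =
      eval hd ((OSTerm.one [.up, .up]).smul ((q : k) - (q⁻¹ : kˣ))) := by
  ext ⟨r⟩
  change cross q t d .pos r (r + 2) le_rfl + (-1 : k) • cross q t d .neg r (r + 2) le_rfl =
    ((q : k) - (q⁻¹ : kˣ)) • 𝟙 (B (r + 2) : IQBrauer q t d)
  rw [cross_pos]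
  simp

theorem eval_left_curl :
    eval hd (((OSTerm.gen .rightCup).tensor (.one [.up])).comp
      (((OSTerm.one [.down]).tensor (.gen .posCross)).comp
        ((OSTerm.gen .leftCap).tensor (.one [.up])))) =
      eval hd ((OSTerm.one [.up]).smul (t : k)) := by
  ext ⟨r⟩
  have h₁ : (eval hd ((OSTerm.gen .rightCup).tensor (.one [.up]))).app (B r) =
      cupMove q t d .pos r (r + 1) (by omega) :=
    (eq_of_heq (eval_tensor_one_app_heq hd _ _ _)).trans (addStrand_map_cupMove .pos r r le_rfl)
  have h₂ : (eval hd ((OSTerm.one [.down]).tensor (.gen .posCross))).app (B r) =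
      cross q t d .pos (r + 1) (r + 3) (by omega) :=
    eq_of_heq (eval_one_tensor_app_heq hd _ _ _)
  have h₃ : (eval hd ((OSTerm.gen .leftCap).tensor (.one [.up]))).app (B r) =
      capMove q t d .pos r (r + 1) (by omega) :=
    (eq_of_heq (eval_tensor_one_app_heq hd _ _ _)).trans (addStrand_map_capMove .pos r r le_rfl)
  exact (congrArg₂ (· ≫ ·) h₁ (congrArg₂ (· ≫ ·) h₂ h₃)).trans
    (cupMove_curl_left .pos hd (r + 1) r le_rfl)

/-- The scalars of the left cup and the right cap cancel each other here, so the value `t` comes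
from the curl alone. -/
theorem eval_right_curl :
    eval hd (((OSTerm.one [.up]).tensor (.gen .leftCup)).comp
      (((OSTerm.gen .posCross).tensor (.one [.down])).comp
        ((OSTerm.one [.up]).tensor (.gen .rightCap)))) =
      eval hd ((OSTerm.one [.up]).smul (t : k)) := by
  ext ⟨r⟩
  have h₁ : (eval hd ((OSTerm.one [.up]).tensor (.gen .leftCup))).app (B r) =
      ((q⁻¹ * t : kˣ) : k) • cupMove q t d .neg (r + 1) (r + 1) le_rfl :=
    eq_of_heq (eval_one_tensor_app_heq hd _ _ _)
  have h₂ : (eval hd ((OSTerm.gen .posCross).tensor (.one [.down]))).app (B r) =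
      cross q t d .pos r (r + 3) (by omega) :=
    eq_of_heq (eval_tensor_one_app_heq hd _ _ _)
  have h₃ : (eval hd ((OSTerm.one [.up]).tensor (.gen .rightCap))).app (B r) =
      ((q * t⁻¹ : kˣ) : k) • capMove q t d .neg (r + 1) (r + 1) le_rfl :=
    eq_of_heq (eval_one_tensor_app_heq hd _ _ _)
  refine (congrArg₂ (· ≫ ·) h₁ (congrArg₂ (· ≫ ·) h₂ h₃)).trans ?_
  change (((q⁻¹ * t : kˣ) : k) • cupMove q t d .neg (r + 1) (r + 1) _) ≫
    cross q t d .pos r (r + 3) _ ≫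
    (((q * t⁻¹ : kˣ) : k) • capMove q t d .neg (r + 1) (r + 1) le_rfl) =
    (t : k) • 𝟙 (B (r + 1) : IQBrauer q t d)
  rw [Linear.comp_smul, Linear.comp_smul, Linear.smul_comp, smul_smul]
  refine (congrArg (_ • ·) (cupMove_curl_right .neg hd (r + 1) r le_rfl)).trans ?_
  rw [← Units.val_mul, mul_mul_mul_comm, mul_inv_cancel, inv_mul_cancel, one_mul, Units.val_one,
    one_smul, CrossSign.unitPow_neg, inv_inv]

theorem eval_bubble :
    eval hd ((OSTerm.gen .leftCup).comp (.gen .rightCap)) = eval hd ((OSTerm.one []).smul d) := by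
  ext ⟨r⟩
  change (((q⁻¹ * t : kˣ) : k) • cupMove q t d .neg r r le_rfl) ≫
    (((q * t⁻¹ : kˣ) : k) • capMove q t d .neg r r le_rfl) = d • 𝟙 (B r : IQBrauer q t d)
  rw [Linear.comp_smul, Linear.smul_comp, smul_smul, cupMove_capMove, ← Units.val_mul,
    mul_mul_mul_comm, mul_inv_cancel, inv_mul_cancel, one_mul, Units.val_one, one_smul]

theorem eval_zigzag_up :
    eval hd (((OSTerm.one [.up]).tensor (.gen .rightCup)).comp
      ((OSTerm.gen .rightCap).tensor (.one [.up]))) = eval hd (OSTerm.one [.up]) := by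
  ext ⟨r⟩
  have h₁ : (eval hd ((OSTerm.one [.up]).tensor (.gen .rightCup))).app (B r) =
      cupMove q t d .pos (r + 1) (r + 1) le_rfl :=
    eq_of_heq (eval_one_tensor_app_heq hd _ _ _)
  have h₂ : (eval hd ((OSTerm.gen .rightCap).tensor (.one [.up]))).app (B r) =
      ((q * t⁻¹ : kˣ) : k) • capMove q t d .neg r (r + 1) (by omega) :=
    (eq_of_heq (eval_tensor_one_app_heq hd _ _ _)).trans
      (((addStrand q t d).map_smul _ _).trans
        (congrArg (_ • ·) (addStrand_map_capMove .neg r r le_rfl)))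
  refine (congrArg₂ (· ≫ ·) h₁ h₂).trans ?_
  change cupMove q t d .pos (r + 1) (r + 1) _ ≫
    (((q * t⁻¹ : kˣ) : k) • capMove q t d .neg r (r + 1) _) = 𝟙 (B (r + 1) : IQBrauer q t d)
  rw [Linear.comp_smul]
  refine (congrArg (_ • ·) (cupMove_zigzag .pos hd (r + 1) r le_rfl)).trans ?_
  rw [smul_smul, ← Units.val_mul, CrossSign.unitPow_pos, CrossSign.unitPow_pos,
    mul_mul_mul_comm, mul_inv_cancel, inv_mul_cancel, one_mul, Units.val_one, one_smul]

theorem eval_zigzag_down :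
    eval hd (((OSTerm.gen .rightCup).tensor (.one [.down])).comp
      ((OSTerm.one [.down]).tensor (.gen .rightCap))) = eval hd (OSTerm.one [.down]) := by
  ext ⟨r⟩
  have h₁ : (eval hd ((OSTerm.gen .rightCup).tensor (.one [.down]))).app (B r) =
      cupMove q t d .pos r (r + 1) (by omega) :=
    (eq_of_heq (eval_tensor_one_app_heq hd _ _ _)).trans (addStrand_map_cupMove .pos r r le_rfl)
  have h₂ : (eval hd ((OSTerm.one [.down]).tensor (.gen .rightCap))).app (B r) =
      ((q * t⁻¹ : kˣ) : k) • capMove q t d .neg (r + 1) (r + 1) le_rfl :=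
    eq_of_heq (eval_one_tensor_app_heq hd _ _ _)
  refine (congrArg₂ (· ≫ ·) h₁ h₂).trans ?_
  change cupMove q t d .pos r (r + 1) _ ≫
    (((q * t⁻¹ : kˣ) : k) • capMove q t d .neg (r + 1) (r + 1) _) = 𝟙 (B (r + 1) : IQBrauer q t d)
  rw [Linear.comp_smul]
  refine (congrArg (_ • ·) (cupMove_zigzag' .pos hd (r + 1) r le_rfl)).trans ?_
  rw [smul_smul, ← Units.val_mul, CrossSign.unitPow_pos, CrossSign.unitPow_pos,
    mul_mul_mul_comm, mul_inv_cancel, inv_mul_cancel, one_mul, Units.val_one, one_smul]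

/-- Associativity of the horizontal composition, up to equalities of functors. -/
theorem hcomp_assoc_of_eq {C : Type*} [Category C] {F₁ F₂ F₃ G₁ G₂ G₃ F₁₂ F₂₃ F₁₂₃ F₁₂₃'
    G₁₂ G₂₃ G₁₂₃ G₁₂₃' : C ⥤ C} (α : F₁ ⟶ G₁) (β : F₂ ⟶ G₂) (γ : F₃ ⟶ G₃)
    (h₁ : F₁₂ = F₁ ⋙ F₂) (h₂ : F₁₂₃ = F₁₂ ⋙ F₃) (h₃ : F₂₃ = F₂ ⋙ F₃) (h₄ : F₁₂₃' = F₁ ⋙ F₂₃)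
    (h₁' : G₁₂ = G₁ ⋙ G₂) (h₂' : G₁₂₃ = G₁₂ ⋙ G₃) (h₃' : G₂₃ = G₂ ⋙ G₃)
    (h₄' : G₁₂₃' = G₁ ⋙ G₂₃) (h : F₁₂₃ = F₁₂₃') (h' : G₁₂₃' = G₁₂₃) :
    eqToHom h₂ ≫ ((eqToHom h₁ ≫ (α ◫ β) ≫ eqToHom h₁'.symm) ◫ γ) ≫ eqToHom h₂'.symm =
      eqToHom h ≫ (eqToHom h₄ ≫ (α ◫ (eqToHom h₃ ≫ (β ◫ γ) ≫ eqToHom h₃'.symm)) ≫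
        eqToHom h₄'.symm) ≫ eqToHom h' := by
  subst h₁ h₂ h₃ h₄ h₁' h₂' h₃' h₄'
  ext X
  simp

theorem eval_rel {X Y : List Strand} {f g : OSTerm k X Y} (h : OSRel q t d f g) :
    eval hd f = eval hd g := by
  induction h with
  | refl f => rfl
  | symm _ ih => exact ih.symm
  | trans _ _ ih ih' => exact ih.trans ih'
  | comp_congr _ _ ih ih' => simp only [eval, ih, ih']
  | tensor_congr _ _ ih ih' => simp only [eval, ih, ih']
  | add_congr _ _ ih ih' => simp only [eval, ih, ih']
  | smul_congr a _ ih => simp only [eval, ih]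
  | id_comp f => exact Category.id_comp _
  | comp_id f => exact Category.comp_id _
  | comp_assoc f g h => exact Category.assoc _ _ _
  | add_assoc f g h => exact add_assoc _ _ _
  | add_comm f g => exact add_comm _ _
  | zero_add f => exact zero_add _
  | neg_add f => simp [eval]
  | one_smul f => exact one_smul _ _
  | mul_smul a b f => exact mul_smul _ _ _
  | smul_add a f g => exact smul_add _ _ _
  | add_smul a b f => exact add_smul _ _ _
  | add_comp f f' g => exact Preadditive.add_comp _ _ _ _ _ _
  | comp_add f g g' => exact Preadditive.comp_add _ _ _ _ _ _
  | smul_comp a f g => exact Linear.smul_comp _ _ _ _ _ _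
  | comp_smul a f g => exact Linear.comp_smul _ _ _ _ _ _
  | add_tensor f f' g =>
    ext Z
    simp [eval, Functor.map_add]
  | tensor_add f g g' =>
    ext Z
    simp [eval]
  | smul_tensor a f g =>
    ext Z
    simp [eval, Functor.map_smul]
  | tensor_smul a f g =>
    ext Z
    simp [eval]
  | id_tensor_id X Y =>
    ext Z
    simp [eval]
  | tensor_comp f g f' g' =>
    simp only [eval, Category.assoc, eqToHom_trans_assoc, eqToHom_refl, Category.id_comp,
      NatTrans.exchange]
  | tensor_assoc f g h =>
    rw [eval_cast]
    -- Once the functors of concatenated words are replaced by composites, this is the associativity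
    -- of horizontal composition.
    exact hcomp_assoc_of_eq _ _ _ _ _ _ _ (addWord_append _ _) (addWord_append _ _)
      (addWord_append _ _) (addWord_append _ _) _ _
  | unit_tensor f =>
    ext Z
    exact eq_of_heq (eval_one_tensor_app_heq hd [] f Z)
  | tensor_unit f =>
    ext Z
    rw [eval_cast]
    refine eq_of_heq ((eval_tensor_one_app_heq hd [] f Z).trans ?_)
    simp only [NatTrans.comp_app, eqToHom_app]
    exact (eqToHom_comp_heq' _ _ _).symm
  | pos_neg => exact crossNatTrans_pos_neg
  | neg_pos => exact crossNatTrans_neg_pos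
  | braid => exact eval_braid hd
  | right_left =>
    exact (congrArg₂ (· ≫ ·) (eval_posRightCross hd) (eval_negLeftCross hd)).trans
      crossNatTrans_pos_neg
  | left_right =>
    exact (congrArg₂ (· ≫ ·) (eval_negLeftCross hd) (eval_posRightCross hd)).trans
      crossNatTrans_neg_pos
  | skein => exact eval_skein hd
  | left_curl => exact eval_left_curl hd
  | right_curl => exact eval_right_curl hd
  | bubble => exact eval_bubble hd
  | zigzag_up => exact eval_zigzag_up hd
  | zigzag_down => exact eval_zigzag_down hd

end Action

/-! ### The module category -/

section Module

variable (hd : d * ((q : k) - (q⁻¹ : kˣ)) = (t : k) - (t⁻¹ : kˣ))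

/-- The functor that adds strands, as a linear endofunctor. -/
def addWordEnd (q t : kˣ) (d : k) (X : List Strand) : LinEndRev k (IQBrauer q t d) :=
  ⟨addWord q t d X, addWord_additive X, addWord_linear X⟩

theorem addWordEnd_append (X Y : List Strand) :
    addWordEnd q t d X ⊗ addWordEnd q t d Y = addWordEnd q t d (X ++ Y) :=
  ObjectProperty.FullSubcategory.ext (addWord_append X Y).symm

/-- The functor underlying the action of the oriented skein category. -/
def action : OSkein q t d ⥤ LinEndRev k (IQBrauer q t d) where
  obj X := addWordEnd q t d X.word
  map {X Y} f := ObjectProperty.homMk (X := addWordEnd q t d X.word) (Y := addWordEnd q t d Y.word)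
    (Quot.lift (eval hd) (fun _ _ h => eval_rel hd h) f)
  map_id _ := rfl
  map_comp := by rintro X Y Z ⟨f⟩ ⟨g⟩; rfl

instance action_additive : (action hd).Additive where
  map_add := by rintro X Y ⟨f⟩ ⟨g⟩; rfl

instance action_linear : (action hd).Linear k where
  map_smul := by rintro X Y ⟨f⟩ a; rfl

/-! ### Coherence of the identity structure morphisms -/

theorem linEndRev_eqToHom_hom {M : Type w} [Category.{v} M] [Preadditive M] [Linear k M]
    {F G : LinEndRev k M} (h : F = G) :
    (eqToHom h).hom = eqToHom (congrArg ObjectProperty.FullSubcategory.obj h) := by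
  subst h
  rfl

theorem eqToHom_addWordEnd_append_hom (X Y : List Strand) :
    ((eqToHom (addWordEnd_append X Y)).hom :
      addWord q t d X ⋙ addWord q t d Y ⟶ addWord q t d (X ++ Y)) =
      eqToHom (addWord_append X Y).symm :=
  linEndRev_eqToHom_hom _

theorem eqToHom_addWordEnd_hom {X Y : List Strand} (h : X = Y) :
    ((eqToHom (congrArg (addWordEnd q t d) h)).hom : addWord q t d X ⟶ addWord q t d Y) =
      eqToHom (congrArg (addWord q t d) h) :=
  linEndRev_eqToHom_hom _

theorem whiskerRight_eval {X Y : List Strand} (f : OSTerm k X Y) (W : List Strand) :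
    Functor.whiskerRight (eval hd f) (addWord q t d W) ≫ eqToHom (addWord_append Y W).symm =
      eqToHom (addWord_append X W).symm ≫ eval hd (f.tensor (.one W)) := by
  ext Z
  simp [eval]

theorem whiskerLeft_eval {X Y : List Strand} (f : OSTerm k X Y) (W : List Strand) :
    Functor.whiskerLeft (addWord q t d W) (eval hd f) ≫ eqToHom (addWord_append W Y).symm =
      eqToHom (addWord_append W X).symm ≫ eval hd ((OSTerm.one W).tensor f) := by
  ext Z
  simp [eval]

theorem addWord_associativity (X Y Z : List Strand) :
    Functor.whiskerRight (eqToHom (addWord_append X Y).symm) (addWord q t d Z) ≫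
      eqToHom (addWord_append (X ++ Y) Z).symm ≫
      eqToHom (congrArg (addWord q t d) (List.append_assoc X Y Z)) =
    𝟙 (addWord q t d X ⋙ addWord q t d Y ⋙ addWord q t d Z) ≫
      Functor.whiskerLeft (addWord q t d X) (eqToHom (addWord_append Y Z).symm) ≫
      eqToHom (addWord_append X (Y ++ Z)).symm := by
  ext W
  simp [eqToHom_map, eqToHom_app]

theorem whiskerLeft_id_comp_eqToHom {C : Type*} [Category C] {F G : C ⥤ C} (h : G = F ⋙ 𝟭 C)
    (h' : G = F) :
    Functor.whiskerLeft F (𝟙 (𝟭 C)) ≫ eqToHom h.symm ≫ eqToHom h' = 𝟙 F := by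
  subst h'
  ext X
  simp

theorem action_map_associator (X Y Z : OSkein q t d) :
    InducedCategory.Hom.hom ((action hd).map (MonoidalCategory.associator X Y Z).hom) =
      eqToHom (congrArg (addWord q t d) (List.append_assoc X.word Y.word Z.word)) := by
  rw [OSkein.associator_hom, eqToHom_map]
  exact eqToHom_addWordEnd_hom (List.append_assoc X.word Y.word Z.word)

theorem action_map_rightUnitor (X : OSkein q t d) :
    InducedCategory.Hom.hom ((action hd).map (MonoidalCategory.rightUnitor X).hom) =
      eqToHom (congrArg (addWord q t d) (List.append_nil X.word)) := by
  rw [OSkein.rightUnitor_hom, eqToHom_map]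
  exact eqToHom_addWordEnd_hom (List.append_nil X.word)

/-- The structure morphisms of the action are identities. -/
def actionCoreMonoidal : (action hd).CoreMonoidal where
  εIso := Iso.refl _
  μIso X Y := eqToIso (addWordEnd_append X.word Y.word)
  μIso_hom_natural_left := by
    rintro X Y ⟨f⟩ Z
    apply ObjectProperty.hom_ext
    -- Up to unfolding, the goal is an equation between natural transformations of word functors;
    -- only the structure isomorphisms must be rewritten as equalities of functors.
    exact (congrArg (Functor.whiskerRight (eval hd f) (addWord q t d Z.word) ≫ ·)
      (eqToHom_addWordEnd_append_hom Y.word Z.word)).trans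
      ((whiskerRight_eval hd f Z.word).trans
      (congrArg (· ≫ eval hd (f.tensor (.one Z.word)))
        (eqToHom_addWordEnd_append_hom X.word Z.word)).symm)
  μIso_hom_natural_right := by
    rintro X Y Z ⟨f⟩
    apply ObjectProperty.hom_ext
    exact (congrArg (Functor.whiskerLeft (addWord q t d Z.word) (eval hd f) ≫ ·)
      (eqToHom_addWordEnd_append_hom Z.word Y.word)).trans
      ((whiskerLeft_eval hd f Z.word).trans
      (congrArg (· ≫ eval hd ((OSTerm.one Z.word).tensor f))
        (eqToHom_addWordEnd_append_hom Z.word X.word)).symm)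
  associativity := by
    intro X Y Z
    apply ObjectProperty.hom_ext
    have h₁ := congrArg₂ (· ≫ ·) (congrArg (Functor.whiskerRight · (addWord q t d Z.word))
      (eqToHom_addWordEnd_append_hom X.word Y.word)) (congrArg₂ (· ≫ ·)
      (eqToHom_addWordEnd_append_hom (X.word ++ Y.word) Z.word) (action_map_associator hd X Y Z))
    have h₂ := congrArg
      (𝟙 (addWord q t d X.word ⋙ addWord q t d Y.word ⋙ addWord q t d Z.word) ≫ ·)
      (congrArg₂ (· ≫ ·) (congrArg (Functor.whiskerLeft (addWord q t d X.word) ·)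
        (eqToHom_addWordEnd_append_hom Y.word Z.word))
        (eqToHom_addWordEnd_append_hom X.word (Y.word ++ Z.word)))
    exact h₁.trans ((addWord_associativity X.word Y.word Z.word).trans h₂.symm)
  left_unitality := by
    intro X
    apply ObjectProperty.hom_ext
    have h : Functor.whiskerRight (𝟙 (𝟭 _)) (addWord q t d X.word) ≫
        (𝟙 (addWord q t d X.word) ≫ 𝟙 (addWord q t d X.word)) = 𝟙 (addWord q t d X.word) := by
      ext W
      simp
    exact h.symm
  right_unitality := by
    intro X
    apply ObjectProperty.hom_ext
    exact (whiskerLeft_id_comp_eqToHom (addWord_append X.word []) (congrArg (addWord q t d)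
      (List.append_nil X.word))).symm.trans
      (congrArg (Functor.whiskerLeft (addWord q t d X.word) (𝟙 (𝟭 _)) ≫ ·)
        (congrArg₂ (· ≫ ·) (eqToHom_addWordEnd_append_hom X.word [])
          (action_map_rightUnitor hd X))).symm

end Module

end IQBrauer

theorem mainTheorem5 {k : Type u} [CommRing k] (q t : kˣ) (d : k)
    (hd : d * ((q : k) - (q⁻¹ : kˣ)) = (t : k) - (t⁻¹ : kˣ)) :
    ∃ A : StrictRightModule k (OSkein q t d) (IQBrauer q t d),
      (A.functor.obj (OSkein.up q t d)).obj = IQBrauer.addStrand q t d ∧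
      (A.functor.obj (OSkein.down q t d)).obj = IQBrauer.addStrand q t d ∧
      ∀ r : ℕ,
        SameHom ((A.functor.map (OSkein.posCross q t d)).hom.app (IQBrauer.B r))
          (IQBrauer.cross q t d .pos r (r + 2) le_rfl) ∧
        SameHom ((A.functor.map (OSkein.negCross q t d)).hom.app (IQBrauer.B r))
          (IQBrauer.cross q t d .neg r (r + 2) le_rfl) ∧
        SameHom ((A.functor.map (OSkein.rightCup q t d)).hom.app (IQBrauer.B r))
          (IQBrauer.rightCup q t d r) ∧
        SameHom ((A.functor.map (OSkein.rightCap q t d)).hom.app (IQBrauer.B r))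
          (IQBrauer.rightCap q t d r) ∧
        SameHom ((A.functor.map (OSkein.leftCup q t d)).hom.app (IQBrauer.B r))
          (IQBrauer.leftCup q t d r) ∧
        SameHom ((A.functor.map (OSkein.leftCap q t d)).hom.app (IQBrauer.B r))
          (IQBrauer.leftCap q t d r) := by
  have sameHom_of_eq {X Y : IQBrauer q t d} {f g : X ⟶ Y} (h : f = g) : SameHom f g :=
    ⟨rfl, rfl, by simp [h]⟩
  refine ⟨{
    functor := IQBrauer.action hd
    additive := inferInstance
    linear := inferInstance
    monoidal := (IQBrauer.actionCoreMonoidal hd).toMonoidal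
    unit_strict := ⟨rfl, rfl⟩
    tensor_strict := fun X Y => ⟨IQBrauer.addWordEnd_append X.word Y.word, rfl⟩ },
    -- The prescribed components unfold to the crossings and to `cupMove` and `capMove` of full
    -- length `r`, with the same scalars, so no transport is needed.
    rfl, rfl, fun r => ⟨sameHom_of_eq rfl, sameHom_of_eq rfl, sameHom_of_eq rfl,
      sameHom_of_eq rfl, sameHom_of_eq rfl, sameHom_of_eq rfl⟩⟩
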